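/- Let $g_0\colon\mathbb{R}\to\mathbb{R}$ be a bounded $C^2$ function, set $\phi_0=g_0-g_0''$, and suppose that for some $M$ $$\sup_{y\in\mathbb{R}} y^2|\phi_0(y)|\le M .$$ Then there is a $T>0$ such that the Cauchy problem $$g_t-g_{tyy}+4g^2-4gg_{yy}=y\,g\,g_{yyy}-y\,g_y\,g_{yy},\qquad g(0,y)=g_0(y),$$ has exactly one solution $g$ on $[0,T)\times\mathbb{R}$. Here a solution is a function $g\colon[0,T)\times\mathbb{R}\to\mathbb{R}$ such that: $g(t,\cdot)$ is $C^2$ for each $t\in[0,T)$; $g_t$ exists (one-sided at $t=0$), and $g,g_y,g_{yy},g_t$ are continuous on $[0,T)\times\mathbb{R}$; $g$ is bounded on $[0,T']\times\mathbb{R}$ for every $T'<T$; $g(0,\cdot)=g_0$; and for each $t\in[0,T)$ the equation holds in the sense of distributions in $y$, that is, for every $\psi\in C_c^\infty(\mathbb{R})$, $$\int_{\mathbb{R}}\Big[g_t(\psi-\psi'')+(4g^2-4gg_{yy})\psi\Big]dy=\int_{\mathbb{R}}\Big[-g_{yy}\,(y\,g\,\psi)_y-y\,g_y\,g_{yy}\,\psi\Big]dy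 .$$ -/

import Mathlib

open Set

/-- `∂g/∂t` at `(t, y)` for a function `g` on `[0, T) × ℝ` (one-sided at `t = 0`). -/
noncomputable def timeDeriv (T : ℝ) (g : ℝ → ℝ → ℝ) (t y : ℝ) : ℝ :=
  derivWithin (fun s => g s y) (Ico 0 T) t

/-- The equation `g_t - g_{tyy} + 4 g² - 4 g g_{yy} = y g g_{yyy} - y g_y g_{yy}` at the time `t`,
in the sense of distributions on `ℝ`. The functions `g`, `g_t`, `g_y`, `g_{yy}` are ordinary
continuous functions; only `g_{tyy}`, the second `y`-derivative of `g_t`, and `g_{yyy}`, the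
`y`-derivative of `g_{yy}`, are distributional derivatives, so that
`⟨g_{tyy}, ψ⟩ = ∫ g_t ψ''` and `⟨y g g_{yyy}, ψ⟩ = ⟨g_{yyy}, y g ψ⟩ = - ∫ g_{yy} (y g ψ)'`. -/
def EquationAt (T : ℝ) (g : ℝ → ℝ → ℝ) (t : ℝ) : Prop :=
  ∀ ψ : ℝ → ℝ, ContDiff ℝ (⊤ : ℕ∞) ψ → HasCompactSupport ψ →
    ∫ y, (timeDeriv T g t y * (ψ y - deriv (deriv ψ) y)
        + (4 * g t y ^ 2 - 4 * g t y * deriv (deriv (g t)) y) * ψ y)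
      = ∫ y, (- (deriv (deriv (g t)) y * deriv (fun x => x * g t x * ψ x) y)
        - y * deriv (g t) y * deriv (deriv (g t)) y * ψ y)

/-- `g` is a solution on `[0, T) × ℝ` of the Cauchy problem
`g_t - g_{tyy} + 4 g² - 4 g g_{yy} = y g g_{yyy} - y g_y g_{yy}`, `g(0, ·) = g₀`:
it is `C²` in `y` and `C¹` in `t`, with `g, g_y, g_{yy}, g_t` continuous on `[0, T) × ℝ`, it is
bounded on `[0, T'] × ℝ` for every `T' < T` (this selects the solution
`½ ∫ exp (-|y - y'|) φ(t, y') dy'` of `g - g_{yy} = φ`), and it satisfies the equation in the sense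
of distributions in `y` at every time. -/
structure IsSolution (T : ℝ) (g₀ : ℝ → ℝ) (g : ℝ → ℝ → ℝ) : Prop where
  contDiff_space : ∀ t ∈ Ico 0 T, ContDiff ℝ 2 (g t)
  continuousOn : ContinuousOn (fun p : ℝ × ℝ => g p.1 p.2) (Ico 0 T ×ˢ univ)
  continuousOn_deriv : ContinuousOn (fun p : ℝ × ℝ => deriv (g p.1) p.2) (Ico 0 T ×ˢ univ)
  continuousOn_deriv_deriv :
    ContinuousOn (fun p : ℝ × ℝ => deriv (deriv (g p.1)) p.2) (Ico 0 T ×ˢ univ)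
  differentiableOn_time : ∀ y, DifferentiableOn ℝ (fun s => g s y) (Ico 0 T)
  continuousOn_timeDeriv :
    ContinuousOn (fun p : ℝ × ℝ => timeDeriv T g p.1 p.2) (Ico 0 T ×ˢ univ)
  bounded : ∀ T' < T, ∃ C : ℝ, ∀ t ∈ Icc 0 T', ∀ y, |g t y| ≤ C
  equation : ∀ t ∈ Ico 0 T, EquationAt T g t
  initial : ∀ y, g 0 y = g₀ y

/-!
With `φ = g - g_{yy}` and `u = y g` the equation becomes the transport equation
`φ_t + u φ_y = (y g_y - 4 g) φ`. Let `Y(t, η)` be the flow of `u`, which fixes the origin, let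
`q = Y_η` be its stretching, and let `A = Y / η` be the mean of `q` between `0` and `η`. Since
`q_t = q (g + Y g_y)` and `A_t = A g` along the flow, `φ(t, Y) = φ₀ q A⁻⁵`. As `g` is bounded, it is
`½ ∫ exp (-|y - x|) φ(t, x) dx`. Hence `q` alone determines `Y`, `A`, `φ` and `g`, and the Cauchy
problem turns into an ordinary differential equation `q_t = F(q)`.

*Existence.* On continuous `q` with values in `[1/4, 4]` the labels keep their order, so that no
kernel ever jumps, and `F` is bounded and Lipschitz for the supremum norm. The factor `Y` in
`Y g_y` is compensated by the decay of `φ₀`, of which only `(1 + |η|) |φ₀ η| ≤ N` is used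
(`Adm.abs_vel_le`, `Adm.abs_vel_sub_le`). Picard–Lindelöf in the space of bounded continuous
functions gives a path `q` (`exists_isPath`), and the Green operator applied to `φ` is the solution
(`IsPath.isSolution`). Its time derivative is taken under the integral in the label, where the
kernel is differentiable except at one point.

*Uniqueness.* Let `h` be any solution. Testing the weak equation with a bump that is carried by a
characteristic and shrinks to a point shows that `h - h_{yy}` obeys the same law
`φ(t, Y) = φ₀ q A⁻⁵` along the flow of `y h` (`IsFlow.solVort_eq_dens`). A solution is bounded, but
nothing is assumed about `h_y` at infinity, so it must be proved that its stretching stays in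
`[1/4, 4]`. This is a domain of dependence argument in label coordinates
(`IsFlow.stretch_mem_of_le`): in a cone `|η| ≤ R (1 - κ (t - t₀))` the value of `Y h_y` is controlled
by the stretching inside the cone, up to an error `R exp (-distance to the edge)`. A particle that is
inside the cone at a later time has stayed away from the edge, at a distance that grows like `κ R`
per unit of time backwards; so the time integral of the error is `O(1/κ)`, uniformly in `R`. After
that the stretchings of both solutions solve `q_t = F(q)` with `F` Lipschitz, and they agree on short
intervals whose length does not depend on the starting time, hence on all of `[0, T)`.
-/

open MeasureTheory Filter Topology

/-! ### The Green operator of `1 - ∂²` on the line -/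

/-- The bounded solution `½ ∫ exp (-|y - x|) f x dx` of `w - w'' = f`. -/
noncomputable def green (f : ℝ → ℝ) (y : ℝ) : ℝ :=
  1 / 2 * ∫ x, Real.exp (-|y - x|) * f x

/-- The derivative of `green f`. -/
noncomputable def greenD (f : ℝ → ℝ) (y : ℝ) : ℝ :=
  1 / 2 * ∫ x, (if x ≤ y then (-1 : ℝ) else 1) * Real.exp (-|y - x|) * f x

theorem integrable_exp_neg_abs : Integrable (fun x : ℝ => Real.exp (-|x|)) := by
  rw [← integrableOn_univ, ← Iic_union_Ioi (a := (0:ℝ))]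
  refine IntegrableOn.union ?_ ?_
  · refine (integrableOn_exp_Iic 0).congr_fun (fun x hx => ?_) measurableSet_Iic
    simp [abs_of_nonpos (show x ≤ 0 from hx)]
  · refine (integrableOn_exp_neg_Ioi 0).congr_fun (fun x hx => ?_) measurableSet_Ioi
    simp [abs_of_pos (show 0 < x from hx)]

theorem integrable_exp_neg_abs_sub (y : ℝ) : Integrable (fun x : ℝ => Real.exp (-|y - x|)) :=
  integrable_exp_neg_abs.comp_sub_left y

theorem integral_exp_neg_abs : ∫ x : ℝ, Real.exp (-|x|) = 2 := by
  have h := integral_comp_abs (f := fun x : ℝ => Real.exp (-x))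
  rw [h, integral_exp_neg_Ioi_zero]; norm_num

theorem integrable_green {f : ℝ → ℝ} (hf : Continuous f) {C : ℝ} (hC : ∀ x, |f x| ≤ C) (y : ℝ) :
    Integrable (fun x => Real.exp (-|y - x|) * f x) :=
  (integrable_exp_neg_abs_sub y).mul_bdd (c := C) hf.aestronglyMeasurable
    (Eventually.of_forall hC)

theorem measurable_side (y : ℝ) : Measurable (fun x : ℝ => if x ≤ y then (-1 : ℝ) else 1) :=
  Measurable.ite measurableSet_Iic measurable_const measurable_const

theorem abs_side (x y : ℝ) : |(if x ≤ y then (-1 : ℝ) else 1)| = 1 := by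
  split_ifs <;> simp

theorem integrable_greenD {f : ℝ → ℝ} (hf : Continuous f) {C : ℝ} (hC : ∀ x, |f x| ≤ C) (y : ℝ) :
    Integrable (fun x => (if x ≤ y then (-1 : ℝ) else 1) * Real.exp (-|y - x|) * f x) := by
  have := (integrable_green hf hC y).bdd_mul (c := 1) (measurable_side y).aestronglyMeasurable
    (Eventually.of_forall fun x => (abs_side x y).le)
  simpa only [mul_assoc] using this

theorem abs_green_le {f : ℝ → ℝ} {C : ℝ} (hC : ∀ x, |f x| ≤ C) (y : ℝ) : |green f y| ≤ C := by
  have h : ‖∫ x, Real.exp (-|y - x|) * f x‖ ≤ ∫ x, Real.exp (-|y - x|) * C :=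
    norm_integral_le_of_norm_le ((integrable_exp_neg_abs_sub y).mul_const C)
      (Eventually.of_forall fun x => by
        rw [norm_mul, Real.norm_eq_abs, Real.abs_exp]
        exact mul_le_mul_of_nonneg_left (hC x) (Real.exp_pos _).le)
  rw [integral_mul_const, integral_sub_left_eq_self (fun x => Real.exp (-|x|)) volume y,
    integral_exp_neg_abs] at h
  rw [green, abs_mul, abs_of_pos (by norm_num : (0:ℝ) < 1/2)]
  rw [Real.norm_eq_abs] at h
  linarith

theorem abs_greenD_le {f : ℝ → ℝ} {C : ℝ} (hC : ∀ x, |f x| ≤ C) (y : ℝ) : |greenD f y| ≤ C := by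
  have h : ‖∫ x, (if x ≤ y then (-1 : ℝ) else 1) * Real.exp (-|y - x|) * f x‖
      ≤ ∫ x, Real.exp (-|y - x|) * C :=
    norm_integral_le_of_norm_le ((integrable_exp_neg_abs_sub y).mul_const C)
      (Eventually.of_forall fun x => by
        rw [norm_mul, norm_mul, Real.norm_eq_abs, Real.norm_eq_abs, abs_side, one_mul,
          Real.abs_exp]
        exact mul_le_mul_of_nonneg_left (hC x) (Real.exp_pos _).le)
  rw [integral_mul_const, integral_sub_left_eq_self (fun x => Real.exp (-|x|)) volume y,
    integral_exp_neg_abs] at h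
  rw [greenD, abs_mul, abs_of_pos (by norm_num : (0:ℝ) < 1/2)]
  rw [Real.norm_eq_abs] at h
  linarith

section Derivatives

variable {f : ℝ → ℝ} (hf : Continuous f) {C : ℝ} (hC : ∀ x, |f x| ≤ C)
include hf hC

theorem hasDerivAt_integral_Iic_exp (y : ℝ) :
    HasDerivAt (fun y => ∫ x in Iic y, Real.exp x * f x) (Real.exp y * f y) y := by
  have hc : Continuous fun x => Real.exp x * f x := Real.continuous_exp.mul hf
  have hi : ∀ b, IntegrableOn (fun x => Real.exp x * f x) (Iic b) := fun b =>
    (integrableOn_exp_Iic b).mul_bdd (c := C) hf.aestronglyMeasurable (Eventually.of_forall hC)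
  have he : (fun y => ∫ x in Iic y, Real.exp x * f x)
      = fun y => (∫ x in Iic 0, Real.exp x * f x) + ∫ x in (0:ℝ)..y, Real.exp x * f x := by
    ext y
    rw [← intervalIntegral.integral_Iic_sub_Iic (hi 0) (hi y)]; ring
  rw [he]
  exact (hc.integral_hasStrictDerivAt 0 y).hasDerivAt.const_add _

theorem hasDerivAt_integral_Ioi_exp (y : ℝ) :
    HasDerivAt (fun y => ∫ x in Ioi y, Real.exp (-x) * f x) (-(Real.exp (-y) * f y)) y := by
  have hc : Continuous fun x => Real.exp (-x) * f x := by fun_prop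
  have hi : ∀ b, IntegrableOn (fun x => Real.exp (-x) * f x) (Ioi b) := fun b =>
    (integrableOn_exp_neg_Ioi b).mul_bdd (c := C) hf.aestronglyMeasurable (Eventually.of_forall hC)
  have he : (fun y => ∫ x in Ioi y, Real.exp (-x) * f x)
      = fun y => (∫ x in Ioi 0, Real.exp (-x) * f x) - ∫ x in (0:ℝ)..y, Real.exp (-x) * f x := by
    ext y
    rw [← intervalIntegral.integral_Ioi_sub_Ioi' (hi 0) (hi y)]; ring
  rw [he]
  exact (hc.integral_hasStrictDerivAt 0 y).hasDerivAt.const_sub _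

/-- The two one-sided halves of `green`, whose integrands no longer depend on the end point. -/
theorem green_eq (y : ℝ) : green f y = 1 / 2 * (Real.exp (-y) * (∫ x in Iic y, Real.exp x * f x)
    + Real.exp y * ∫ x in Ioi y, Real.exp (-x) * f x) := by
  have hi := integrable_green hf hC y
  rw [green, ← intervalIntegral.integral_Iic_add_Ioi (b := y) hi.integrableOn hi.integrableOn,
    ← integral_const_mul, ← integral_const_mul]
  congr 2
  · refine setIntegral_congr_fun measurableSet_Iic fun x hx => ?_
    have hx : x ≤ y := hx
    simp only [abs_of_nonneg (sub_nonneg.2 hx), ← mul_assoc, ← Real.exp_add]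
    ring_nf
  · refine setIntegral_congr_fun measurableSet_Ioi fun x hx => ?_
    have hx : y < x := hx
    simp only [abs_of_neg (sub_neg.2 hx), ← mul_assoc, ← Real.exp_add]
    ring_nf

theorem greenD_eq (y : ℝ) :
    greenD f y = 1 / 2 * (-(Real.exp (-y) * (∫ x in Iic y, Real.exp x * f x))
    + Real.exp y * ∫ x in Ioi y, Real.exp (-x) * f x) := by
  have hi := integrable_greenD hf hC y
  rw [greenD, ← intervalIntegral.integral_Iic_add_Ioi (b := y) hi.integrableOn hi.integrableOn,
    ← integral_const_mul, ← integral_const_mul, ← integral_neg]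
  congr 2
  · refine setIntegral_congr_fun measurableSet_Iic fun x hx => ?_
    have hx : x ≤ y := hx
    simp only [abs_of_nonneg (sub_nonneg.2 hx), ← mul_assoc, ← Real.exp_add, if_pos hx]
    ring_nf
  · refine setIntegral_congr_fun measurableSet_Ioi fun x hx => ?_
    have hx : y < x := hx
    simp only [abs_of_neg (sub_neg.2 hx), ← mul_assoc, ← Real.exp_add, if_neg (not_le.2 hx)]
    ring_nf

theorem hasDerivAt_green (y : ℝ) : HasDerivAt (green f) (greenD f y) y := by
  have h1 := hasDerivAt_integral_Iic_exp hf hC y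
  have h2 := hasDerivAt_integral_Ioi_exp hf hC y
  have e1 : HasDerivAt (fun y : ℝ => Real.exp (-y)) (-Real.exp (-y)) y := by
    simpa using (hasDerivAt_neg y).exp
  have h := ((e1.mul h1).add ((Real.hasDerivAt_exp y).mul h2)).const_mul (1 / 2)
  have he : green f = fun y => 1 / 2 * (Real.exp (-y) * (∫ x in Iic y, Real.exp x * f x)
    + Real.exp y * ∫ x in Ioi y, Real.exp (-x) * f x) := funext (green_eq hf hC)
  rw [he]
  refine HasDerivAt.congr_deriv h ?_
  rw [greenD_eq hf hC]
  ring

theorem hasDerivAt_greenD (y : ℝ) : HasDerivAt (greenD f) (green f y - f y) y := by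
  have h1 := hasDerivAt_integral_Iic_exp hf hC y
  have h2 := hasDerivAt_integral_Ioi_exp hf hC y
  have e1 : HasDerivAt (fun y : ℝ => Real.exp (-y)) (-Real.exp (-y)) y := by
    simpa using (hasDerivAt_neg y).exp
  have h := ((e1.mul h1).neg.add ((Real.hasDerivAt_exp y).mul h2)).const_mul (1 / 2)
  have he : greenD f = fun y => 1 / 2 * (-(Real.exp (-y) * (∫ x in Iic y, Real.exp x * f x))
    + Real.exp y * ∫ x in Ioi y, Real.exp (-x) * f x) := funext (greenD_eq hf hC)
  rw [he]
  refine HasDerivAt.congr_deriv h ?_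
  rw [green_eq hf hC]
  have : Real.exp y * Real.exp (-y) = 1 := by rw [← Real.exp_add]; simp
  linear_combination (-f y) * this

theorem deriv_green : deriv (green f) = greenD f :=
  funext fun y => (hasDerivAt_green hf hC y).deriv

theorem deriv_greenD : deriv (greenD f) = fun y => green f y - f y :=
  funext fun y => (hasDerivAt_greenD hf hC y).deriv

theorem continuous_green : Continuous (green f) :=
  continuous_iff_continuousAt.2 fun y => (hasDerivAt_green hf hC y).continuousAt

theorem continuous_greenD : Continuous (greenD f) :=
  continuous_iff_continuousAt.2 fun y => (hasDerivAt_greenD hf hC y).continuousAt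

theorem contDiff_green : ContDiff ℝ 2 (green f) := by
  rw [show (2 : WithTop ℕ∞) = 1 + 1 from rfl, contDiff_succ_iff_deriv]
  refine ⟨fun y => (hasDerivAt_green hf hC y).differentiableAt, by simp, ?_⟩
  rw [deriv_green hf hC, contDiff_one_iff_deriv, deriv_greenD hf hC]
  exact ⟨fun y => (hasDerivAt_greenD hf hC y).differentiableAt, (continuous_green hf hC).sub hf⟩

end Derivatives

section JointContinuity

variable {f : ℝ → ℝ → ℝ} (hf : Continuous (Function.uncurry f)) {C : ℝ}
  (hC : ∀ t x, |f t x| ≤ C)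
include hf hC

theorem continuous_green_uncurry : Continuous fun p : ℝ × ℝ => green (f p.1) p.2 := by
  have he : (fun p : ℝ × ℝ => green (f p.1) p.2)
      = fun p => 1 / 2 * ∫ z, Real.exp (-|z|) * f p.1 (p.2 - z) := by
    ext p
    rw [green, ← integral_sub_left_eq_self _ volume p.2]
    simp
  -- After the substitution `x = y - z` only `f` depends on the parameters.
  rw [he]
  have hf2 : ∀ p : ℝ × ℝ, Continuous fun z => f p.1 (p.2 - z) := fun p =>
    hf.comp (by fun_prop : Continuous fun z => (p.1, p.2 - z))
  refine continuous_const.mul (continuous_of_dominated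
    (bound := fun z => Real.exp (-|z|) * C) (fun p => ?_) (fun p => ?_)
    (integrable_exp_neg_abs.mul_const C) (Eventually.of_forall fun z => ?_))
  · exact (Continuous.mul (by fun_prop) (hf2 p)).aestronglyMeasurable
  · refine Eventually.of_forall fun z => ?_
    rw [norm_mul, Real.norm_eq_abs, Real.abs_exp]
    exact mul_le_mul_of_nonneg_left (hC _ _) (Real.exp_pos _).le
  · exact continuous_const.mul (hf.comp (by fun_prop : Continuous fun p : ℝ × ℝ => (p.1, p.2 - z)))

theorem continuous_greenD_uncurry : Continuous fun p : ℝ × ℝ => greenD (f p.1) p.2 := by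
  have he : (fun p : ℝ × ℝ => greenD (f p.1) p.2)
      = fun p => 1 / 2 * ∫ z, (if 0 ≤ z then (-1 : ℝ) else 1) * Real.exp (-|z|) * f p.1 (p.2 - z) := by
    ext p
    rw [greenD, ← integral_sub_left_eq_self _ volume p.2]
    simp
  rw [he]
  have hf2 : ∀ p : ℝ × ℝ, Continuous fun z => f p.1 (p.2 - z) := fun p =>
    hf.comp (by fun_prop : Continuous fun z => (p.1, p.2 - z))
  have hm : Measurable fun z : ℝ => if 0 ≤ z then (-1 : ℝ) else 1 :=
    Measurable.ite measurableSet_Ici measurable_const measurable_const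
  refine continuous_const.mul (continuous_of_dominated
    (bound := fun z => Real.exp (-|z|) * C) (fun p => ?_) (fun p => ?_)
    (integrable_exp_neg_abs.mul_const C) (Eventually.of_forall fun z => ?_))
  · exact ((hm.mul (by fun_prop)).aestronglyMeasurable).mul (hf2 p).aestronglyMeasurable
  · refine Eventually.of_forall fun z => ?_
    have : |(if 0 ≤ z then (-1 : ℝ) else 1)| = 1 := by split_ifs <;> simp
    rw [norm_mul, norm_mul, Real.norm_eq_abs, Real.norm_eq_abs, Real.abs_exp, this, one_mul]
    exact mul_le_mul_of_nonneg_left (hC _ _) (Real.exp_pos _).le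
  · exact continuous_const.mul (hf.comp (by fun_prop : Continuous fun p : ℝ × ℝ => (p.1, p.2 - z)))

end JointContinuity

/-- A bounded solution of `w'' = w` vanishes. -/
theorem eq_zero_of_bounded_of_deriv_deriv {w w' : ℝ → ℝ} (h1 : ∀ y, HasDerivAt w (w' y) y)
    (h2 : ∀ y, HasDerivAt w' (w y) y) {C : ℝ} (hC : ∀ y, |w y| ≤ C) (y : ℝ) : w y = 0 := by
  -- `(w + w') e^{-y}` and `(w - w') e^y` are constant.
  have hp : ∀ y, (w y + w' y) * Real.exp (-y) = (w 0 + w' 0) * Real.exp (-0) := fun y =>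
    is_const_of_deriv_eq_zero (f := fun y => (w y + w' y) * Real.exp (-y))
      (fun y => (((h1 y).add (h2 y)).mul (hasDerivAt_neg y).exp).differentiableAt)
      (fun y => (((h1 y).add (h2 y)).mul (hasDerivAt_neg y).exp).deriv.trans (by simp; ring)) y 0
  have hm : ∀ y, (w y - w' y) * Real.exp y = (w 0 - w' 0) * Real.exp 0 := fun y =>
    is_const_of_deriv_eq_zero (f := fun y => (w y - w' y) * Real.exp y)
      (fun y => (((h1 y).sub (h2 y)).mul (Real.hasDerivAt_exp y)).differentiableAt)
      (fun y => (((h1 y).sub (h2 y)).mul (Real.hasDerivAt_exp y)).deriv.trans (by simp; ring)) y 0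
  set a := w 0 + w' 0
  set b := w 0 - w' 0
  have hw : ∀ y, 2 * w y = a * Real.exp y + b * Real.exp (-y) := fun y => by
    have e : Real.exp y * Real.exp (-y) = 1 := by rw [← Real.exp_add]; simp
    have h3 := hp y
    have h4 := hm y
    simp only [neg_zero, Real.exp_zero, mul_one] at h3 h4
    rw [← h3, ← h4]
    linear_combination (-(2 * w y)) * e
  have hC0 : 0 ≤ C := (abs_nonneg _).trans (hC 0)
  -- An exponential that stays bounded at infinity has the coefficient zero.
  have key : ∀ a b : ℝ, (∀ y, 0 ≤ y → |a * Real.exp y + b * Real.exp (-y)| ≤ 2 * C) → a = 0 := by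
    intro a b h
    by_contra ha
    have ha' : 0 < |a| := abs_pos.2 ha
    set y := (2 * C + |b|) / |a|
    have hy : 0 ≤ y := by positivity
    have h5 := h y hy
    have h6 : |a| * Real.exp y ≤ |a * Real.exp y + b * Real.exp (-y)| + |b| * Real.exp (-y) := by
      have := abs_sub_abs_le_abs_sub (a * Real.exp y) (-(b * Real.exp (-y)))
      rw [abs_neg, abs_mul, abs_mul, Real.abs_exp, Real.abs_exp, sub_neg_eq_add] at this
      linarith
    have h7 : |b| * Real.exp (-y) ≤ |b| :=
      mul_le_of_le_one_right (abs_nonneg b) (Real.exp_le_one_iff.2 (by linarith))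
    have h8 : |a| * (y + 1) ≤ |a| * Real.exp y :=
      mul_le_mul_of_nonneg_left (Real.add_one_le_exp y) ha'.le
    have h9 : |a| * y = 2 * C + |b| := mul_div_cancel₀ _ ha'.ne'
    nlinarith
  have hb2 : ∀ y, |a * Real.exp y + b * Real.exp (-y)| ≤ 2 * C := fun y => by
    rw [← hw y, abs_mul, abs_two]; linarith [hC y]
  have ha : a = 0 := key a b fun y _ => hb2 y
  have hb : b = 0 := key b a fun y _ => by
    have := hb2 (-y); rwa [neg_neg, add_comm] at this
  have := hw y
  rw [ha, hb] at this
  linarith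

/-- A bounded `C²` function is recovered from `w - w''` by `green`. -/
theorem eq_green {w f : ℝ → ℝ} (hw : ContDiff ℝ 2 w) {C : ℝ} (hC : ∀ y, |w y| ≤ C)
    {C' : ℝ} (hC' : ∀ y, |f y| ≤ C') (hf : ∀ y, w y - deriv (deriv w) y = f y) : w = green f := by
  have hw1 : ContDiff ℝ 1 (deriv w) := by
    rw [show (2 : WithTop ℕ∞) = 1 + 1 from rfl, contDiff_succ_iff_deriv] at hw; exact hw.2.2
  have hfc : Continuous f := by
    rw [← show (fun y => w y - deriv (deriv w) y) = f from funext hf]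
    exact hw.continuous.sub (contDiff_one_iff_deriv.1 hw1).2
  ext y
  have := eq_zero_of_bounded_of_deriv_deriv (w := fun y => w y - green f y)
    (w' := fun y => deriv w y - greenD f y)
    (fun y => ((hw.differentiable (by norm_num) y).hasDerivAt).sub (hasDerivAt_green hfc hC' y))
    (fun y => (((hw1.differentiable (by norm_num) y).hasDerivAt).sub
      (hasDerivAt_greenD hfc hC' y)).congr_deriv (by rw [← hf y]; ring))
    (C := C + C') (fun y => (abs_sub _ _).trans (add_le_add (hC y) (abs_green_le hC' y))) y
  linarith

/-! ### The equation in terms of `φ = g - g_{yy}` -/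

theorem integral_mul_deriv_of_hasCompactSupport {a a' b b' : ℝ → ℝ} (ha : ∀ x, HasDerivAt a (a' x) x)
    (hb : ∀ x, HasDerivAt b (b' x) x) (ha' : Continuous a') (hb' : Continuous b')
    (hs : HasCompactSupport b) : ∫ x, a x * b' x = -∫ x, a' x * b x := by
  have hac : Continuous a := continuous_iff_continuousAt.2 fun x => (ha x).continuousAt
  have hbc : Continuous b := continuous_iff_continuousAt.2 fun x => (hb x).continuousAt
  have hs' : HasCompactSupport b' := by
    have := hs.deriv (𝕜 := ℝ)
    rwa [show deriv b = b' from funext fun x => (hb x).deriv] at this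
  exact integral_mul_deriv_eq_deriv_mul_of_integrable (fun x _ => ha x) (fun x _ => hb x)
    ((hac.mul hb').integrable_of_hasCompactSupport hs'.mul_left)
    ((ha'.mul hbc).integrable_of_hasCompactSupport hs.mul_left)
    ((hac.mul hbc).integrable_of_hasCompactSupport hs.mul_left)

theorem ContDiff.continuous_deriv_deriv {v : ℝ → ℝ} (hv : ContDiff ℝ 2 v) :
    Continuous (deriv (deriv v)) := by
  rw [show (2 : WithTop ℕ∞) = 1 + 1 from rfl, contDiff_succ_iff_deriv] at hv
  exact (contDiff_one_iff_deriv.1 hv.2.2).2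

theorem ContDiff.hasDerivAt_deriv_of_two {v : ℝ → ℝ} (hv : ContDiff ℝ 2 v) (y : ℝ) :
    HasDerivAt (deriv v) (deriv (deriv v) y) y := by
  rw [show (2 : WithTop ℕ∞) = 1 + 1 from rfl, contDiff_succ_iff_deriv] at hv
  exact (hv.2.2.differentiable (by norm_num) y).hasDerivAt

/-- The operator `1 - ∂²` is symmetric. -/
theorem integral_mul_sub_deriv_deriv {v ψ : ℝ → ℝ} (hv : ContDiff ℝ 2 v) (hψ : ContDiff ℝ 2 ψ)
    (hs : HasCompactSupport ψ) :
    ∫ y, v y * (ψ y - deriv (deriv ψ) y) = ∫ y, (v y - deriv (deriv v) y) * ψ y := by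
  have h1 : ∫ y, v y * deriv (deriv ψ) y = -∫ y, deriv v y * deriv ψ y :=
    integral_mul_deriv_of_hasCompactSupport
      (fun y => (hv.differentiable (by norm_num) y).hasDerivAt)
      hψ.hasDerivAt_deriv_of_two (hv.continuous_deriv (by norm_num)) hψ.continuous_deriv_deriv
      hs.deriv
  have h2 : ∫ y, deriv v y * deriv ψ y = -∫ y, deriv (deriv v) y * ψ y :=
    integral_mul_deriv_of_hasCompactSupport hv.hasDerivAt_deriv_of_two
      (fun y => (hψ.differentiable (by norm_num) y).hasDerivAt) hv.continuous_deriv_deriv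
      (hψ.continuous_deriv (by norm_num)) hs
  have e1 : (fun y => v y * (ψ y - deriv (deriv ψ) y))
      = fun y => v y * ψ y - v y * deriv (deriv ψ) y := by ext y; ring
  have e2 : (fun y => (v y - deriv (deriv v) y) * ψ y)
      = fun y => v y * ψ y - deriv (deriv v) y * ψ y := by ext y; ring
  have i0 : Integrable fun y => v y * ψ y :=
    (hv.continuous.mul hψ.continuous).integrable_of_hasCompactSupport hs.mul_left
  have i1 : Integrable fun y => v y * deriv (deriv ψ) y :=
    (hv.continuous.mul hψ.continuous_deriv_deriv).integrable_of_hasCompactSupport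
      hs.deriv.deriv.mul_left
  have i2 : Integrable fun y => deriv (deriv v) y * ψ y :=
    (hv.continuous_deriv_deriv.mul hψ.continuous).integrable_of_hasCompactSupport hs.mul_left
  rw [e1, e2, integral_sub i0 i1, integral_sub i0 i2, h1, h2, neg_neg]

/-- The weak equation in terms of `φ = g - g_{yy}`: with `u = y g` it reads
`φ_t + (u φ)_y = (2 u_y - 5 g) φ`, tested against `ψ`. -/
theorem equationAt_iff {T : ℝ} {g : ℝ → ℝ → ℝ} {t : ℝ} (hg : ContDiff ℝ 2 (g t))
    (hγ : Continuous (timeDeriv T g t)) :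
    EquationAt T g t ↔ ∀ ψ : ℝ → ℝ, ContDiff ℝ (⊤ : ℕ∞) ψ → HasCompactSupport ψ →
      ∫ y, timeDeriv T g t y * (ψ y - deriv (deriv ψ) y)
        = ∫ y, (g t y - deriv (deriv (g t)) y) *
          (y * g t y * deriv ψ y + (2 * y * deriv (g t) y - 3 * g t y) * ψ y) := by
  refine forall_congr' fun ψ => forall_congr' fun hψ => forall_congr' fun hs => ?_
  have hψ2 : ContDiff ℝ 2 ψ := contDiff_infty.1 hψ 2
  set v := g t
  have cv := hg.continuous
  have cv1 : Continuous (deriv v) := hg.continuous_deriv (by norm_num)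
  have cv2 := hg.continuous_deriv_deriv
  have cψ := hψ2.continuous
  have cψ1 : Continuous (deriv ψ) := hψ2.continuous_deriv (by norm_num)
  have cψ2 := hψ2.continuous_deriv_deriv
  have hd : ∀ y, HasDerivAt (fun x => x * v x * ψ x)
      ((1 * v y + y * deriv v y) * ψ y + y * v y * deriv ψ y) y := fun y =>
    ((hasDerivAt_id' y).mul (hg.differentiable (by norm_num) y).hasDerivAt).mul
      (hψ2.differentiable (by norm_num) y).hasDerivAt
  -- The derivative of `v · (y v ψ)` has integral zero.
  have hz : ∫ y, (v y * ((1 * v y + y * deriv v y) * ψ y + y * v y * deriv ψ y)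
      + deriv v y * (y * v y * ψ y)) = 0 := by
    rw [integral_add, integral_mul_deriv_of_hasCompactSupport
      (fun y => (hg.differentiable (by norm_num) y).hasDerivAt) hd cv1 (by fun_prop) hs.mul_left]
    · ring
    · refine Continuous.integrable_of_hasCompactSupport (by fun_prop) ?_
      exact (HasCompactSupport.add hs.mul_left hs.deriv.mul_left).mul_left
    · exact Continuous.integrable_of_hasCompactSupport (by fun_prop) hs.mul_left.mul_left
  have i1 : Integrable fun y => timeDeriv T g t y * (ψ y - deriv (deriv ψ) y) := by
    refine Continuous.integrable_of_hasCompactSupport (by fun_prop) ?_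
    exact (HasCompactSupport.sub hs hs.deriv.deriv).mul_left
  have i2 : Integrable fun y => (4 * v y ^ 2 - 4 * v y * deriv (deriv v) y) * ψ y :=
    Continuous.integrable_of_hasCompactSupport (by fun_prop) hs.mul_left
  have i3 : Integrable fun y => (v y - deriv (deriv v) y) *
          (y * v y * deriv ψ y + (2 * y * deriv v y - 3 * v y) * ψ y) :=
    Continuous.integrable_of_hasCompactSupport (by fun_prop)
      (HasCompactSupport.add hs.deriv.mul_left hs.mul_left).mul_left
  have i4 : Integrable fun y => (v y * ((1 * v y + y * deriv v y) * ψ y + y * v y * deriv ψ y)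
      + deriv v y * (y * v y * ψ y)) := by
    refine Continuous.integrable_of_hasCompactSupport (by fun_prop) ?_
    exact HasCompactSupport.add
      (HasCompactSupport.add hs.mul_left hs.deriv.mul_left).mul_left hs.mul_left.mul_left
  have hR : ∫ y, (- (deriv (deriv v) y * deriv (fun x => x * v x * ψ x) y)
        - y * deriv v y * deriv (deriv v) y * ψ y)
      = (∫ y, (v y - deriv (deriv v) y) *
          (y * v y * deriv ψ y + (2 * y * deriv v y - 3 * v y) * ψ y))
        + ∫ y, (4 * v y ^ 2 - 4 * v y * deriv (deriv v) y) * ψ y := by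
    have i5 : Integrable fun y => (v y - deriv (deriv v) y) *
          (y * v y * deriv ψ y + (2 * y * deriv v y - 3 * v y) * ψ y)
        + (4 * v y ^ 2 - 4 * v y * deriv (deriv v) y) * ψ y := i3.add i2
    rw [← integral_add i3 i2, ← sub_zero (∫ y, _ + _), ← hz, ← integral_sub i5 i4]
    refine integral_congr_ae (Eventually.of_forall fun y => ?_)
    simp only [(hd y).deriv]
    ring
  rw [hR, integral_add i1 i2, add_left_inj]

/-! ### Lagrangian variables -/

/-- The mean of `q` over the segment from `0` to `η`. -/
noncomputable def avg (q : ℝ → ℝ) (η : ℝ) : ℝ := ∫ s in (0 : ℝ)..1, q (s * η)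

/-- The position of the particle with the label `η` when the flow has the stretching `q = Y_η`
and fixes the origin. -/
noncomputable def pos (q : ℝ → ℝ) (η : ℝ) : ℝ := ∫ x in (0 : ℝ)..η, q x

/-- The label of the particle at `y`: the inverse of `pos q`. -/
noncomputable def lab (q : ℝ → ℝ) (y : ℝ) : ℝ := Function.invFun (pos q) y

/-- The value of `φ` carried by the particle with the label `η`, when it was `φ₀` initially. -/
noncomputable def dens (φ₀ q : ℝ → ℝ) (η : ℝ) : ℝ := φ₀ η * q η / avg q η ^ 5

/-- The function `φ` in the space variable. -/
noncomputable def vort (φ₀ q : ℝ → ℝ) (y : ℝ) : ℝ := dens φ₀ q (lab q y)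

/-- The right-hand side `Y_η (g + Y g_y)` of the evolution of the stretching `q = Y_η`. -/
noncomputable def vel (φ₀ q : ℝ → ℝ) (η : ℝ) : ℝ :=
  q η * (green (vort φ₀ q) (pos q η) + pos q η * greenD (vort φ₀ q) (pos q η))

/-- The stretchings to which all estimates refer: continuous, with values in `[1/4, 4]`. -/
structure Adm (q : ℝ → ℝ) : Prop where
  cont : Continuous q
  lower : ∀ η, 1 / 4 ≤ q η
  upper : ∀ η, q η ≤ 4

theorem pos_eq_mul_avg (q : ℝ → ℝ) (η : ℝ) : pos q η = η * avg q η := by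
  rw [pos, avg, intervalIntegral.mul_integral_comp_mul_right]; simp

theorem pos_zero (q : ℝ → ℝ) : pos q 0 = 0 := by simp [pos]

theorem avg_const_one : avg (fun _ => 1) = fun _ => 1 := by ext; simp [avg]

namespace Adm

section

variable {q : ℝ → ℝ} (h : Adm q)
include h

theorem q_pos (η : ℝ) : 0 < q η := lt_of_lt_of_le (by norm_num) (h.lower η)

theorem continuous_avg : Continuous (avg q) :=
  intervalIntegral.continuous_parametric_intervalIntegral_of_continuous'
    (f := fun η s => q (s * η)) (h.cont.comp (by fun_prop)) 0 1

theorem lower_avg (η : ℝ) : 1 / 4 ≤ avg q η := by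
  have hc : Continuous fun s => q (s * η) := h.cont.comp (by fun_prop)
  have := intervalIntegral.integral_mono_on (μ := volume) (a := 0) (b := 1) (f := fun _ => (1 / 4 : ℝ))
    (g := fun s => q (s * η)) zero_le_one (by simp) (hc.intervalIntegrable _ _)
    (fun s _ => h.lower _)
  simpa [avg] using this

theorem upper_avg (η : ℝ) : avg q η ≤ 4 := by
  have hc : Continuous fun s => q (s * η) := h.cont.comp (by fun_prop)
  have := intervalIntegral.integral_mono_on (μ := volume) (a := 0) (b := 1) (g := fun _ => (4 : ℝ))
    (f := fun s => q (s * η)) zero_le_one (hc.intervalIntegrable _ _) (by simp)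
    (fun s _ => h.upper _)
  simpa [avg] using this

theorem avg_pos (η : ℝ) : 0 < avg q η := lt_of_lt_of_le (by norm_num) (h.lower_avg η)

theorem hasDerivAt_pos (η : ℝ) : HasDerivAt (pos q) (q η) η :=
  (h.cont.integral_hasStrictDerivAt 0 η).hasDerivAt

theorem continuous_pos : Continuous (pos q) :=
  continuous_iff_continuousAt.2 fun η => (h.hasDerivAt_pos η).continuousAt

theorem pos_sub (a b : ℝ) : pos q b - pos q a = ∫ x in a..b, q x :=
  intervalIntegral.integral_interval_sub_left (h.cont.intervalIntegrable _ _)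
    (h.cont.intervalIntegrable _ _)

theorem le_pos_sub {a b : ℝ} (hab : a ≤ b) : (b - a) / 4 ≤ pos q b - pos q a := by
  have := intervalIntegral.integral_mono_on (μ := volume) (f := fun _ => (1 / 4 : ℝ)) (g := q)
    hab (by simp) (h.cont.intervalIntegrable _ _) (fun s _ => h.lower _)
  rw [h.pos_sub]
  simp only [intervalIntegral.integral_const, smul_eq_mul] at this
  linarith

theorem le_abs_pos_sub (a b : ℝ) : |a - b| / 4 ≤ |pos q a - pos q b| := by
  rcases le_total a b with hab | hab
  · have := h.le_pos_sub hab
    rw [abs_sub_comm, abs_sub_comm (pos q a), abs_of_nonneg (sub_nonneg.2 hab)]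
    exact this.trans (le_abs_self _)
  · have := h.le_pos_sub hab
    rw [abs_of_nonneg (sub_nonneg.2 hab)]
    exact this.trans (le_abs_self _)

theorem le_abs_pos (a : ℝ) : |a| / 4 ≤ |pos q a| := by
  simpa [pos_zero] using h.le_abs_pos_sub a 0

theorem abs_pos_le (a : ℝ) : |pos q a| ≤ 4 * |a| := by
  rw [pos_eq_mul_avg, abs_mul, abs_of_pos (h.avg_pos a), mul_comm]
  exact mul_le_mul_of_nonneg_right (h.upper_avg a) (abs_nonneg _)

theorem strictMono_pos : StrictMono (pos q) := fun a b hab => by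
  have := h.le_pos_sub hab.le
  linarith

theorem surjective_pos : Function.Surjective (pos q) := by
  refine h.continuous_pos.surjective ?_ ?_
  · refine tendsto_atTop_mono' atTop (f₁ := fun η : ℝ => η / 4) ?_
      (tendsto_id.atTop_div_const (by norm_num : (0 : ℝ) < 4))
    filter_upwards [eventually_ge_atTop (0 : ℝ)] with η hη
    have := h.le_pos_sub hη
    rw [pos_zero] at this; linarith
  · refine tendsto_atBot_mono' atBot (f₁ := fun η : ℝ => η / 4) ?_
      (tendsto_id.atBot_div_const (by norm_num : (0 : ℝ) < 4))
    filter_upwards [eventually_le_atBot (0 : ℝ)] with η hη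
    have := h.le_pos_sub hη
    rw [pos_zero] at this; linarith

theorem pos_lab (y : ℝ) : pos q (lab q y) = y := Function.invFun_eq (h.surjective_pos y)

theorem lab_pos (η : ℝ) : lab q (pos q η) = η :=
  Function.leftInverse_invFun h.strictMono_pos.injective η

theorem continuous_lab : Continuous (lab q) := by
  refine LipschitzWith.continuous (K := 4) (LipschitzWith.of_dist_le_mul fun x y => ?_)
  have := h.le_abs_pos_sub (lab q x) (lab q y)
  rw [h.pos_lab, h.pos_lab] at this
  rw [Real.dist_eq, Real.dist_eq]
  norm_num
  linarith

/-- Change of variables from the position to the label. -/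
theorem integral_comp_pos (F : ℝ → ℝ) : ∫ η, F (pos q η) * q η = ∫ y, F y := by
  have := integral_image_eq_integral_abs_deriv_smul (s := univ) (f := pos q) (f' := q)
    MeasurableSet.univ (fun x _ => (h.hasDerivAt_pos x).hasDerivWithinAt)
    h.strictMono_pos.injective.injOn F
  rw [image_univ, h.surjective_pos.range_eq, setIntegral_univ, setIntegral_univ] at this
  rw [this]
  refine integral_congr_ae (Eventually.of_forall fun η => ?_)
  simp [abs_of_pos (h.q_pos η), mul_comm]

/-- The constant is `4 · 4⁵`, from `q ≤ 4` and `A ≥ 1/4`. -/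
theorem abs_dens_le (φ₀ : ℝ → ℝ) (η : ℝ) : |dens φ₀ q η| ≤ 4096 * |φ₀ η| := by
  have h1 := h.lower_avg η
  have h2 := h.upper η
  have h3 := h.q_pos η
  rw [dens, abs_div, abs_mul, abs_of_pos h3, abs_of_pos (pow_pos (h.avg_pos η) 5),
    div_le_iff₀ (pow_pos (h.avg_pos η) 5)]
  have h4 : (1 / 4 : ℝ) ^ 5 ≤ avg q η ^ 5 := pow_le_pow_left₀ (by norm_num) h1 5
  have h5 : q η ≤ 4096 * avg q η ^ 5 := by norm_num at h4; linarith
  nlinarith [abs_nonneg (φ₀ η)]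

theorem vort_pos (φ₀ : ℝ → ℝ) (η : ℝ) : vort φ₀ q (pos q η) = dens φ₀ q η := by
  rw [vort, h.lab_pos]

theorem continuous_dens {φ₀ : ℝ → ℝ} (hφ : Continuous φ₀) : Continuous (dens φ₀ q) :=
  (hφ.mul h.cont).div (h.continuous_avg.pow 5) fun η => (pow_pos (h.avg_pos η) 5).ne'

theorem continuous_vort {φ₀ : ℝ → ℝ} (hφ : Continuous φ₀) : Continuous (vort φ₀ q) :=
  (h.continuous_dens hφ).comp h.continuous_lab

theorem weighted_vort_le {φ₀ : ℝ → ℝ} {N : ℝ} (hN : ∀ η, (1 + |η|) * |φ₀ η| ≤ N) (y : ℝ) :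
    (1 + |y|) * |vort φ₀ q y| ≤ 16384 * N := by
  have h1 := h.abs_pos_le (lab q y)
  rw [h.pos_lab] at h1
  have h2 := h.abs_dens_le φ₀ (lab q y)
  have h3 := hN (lab q y)
  have h4 : 1 + |y| ≤ 4 * (1 + |lab q y|) := by linarith
  calc (1 + |y|) * |vort φ₀ q y| ≤ (4 * (1 + |lab q y|)) * (4096 * |φ₀ (lab q y)|) :=
        mul_le_mul h4 h2 (abs_nonneg _) (by positivity)
    _ = 16384 * ((1 + |lab q y|) * |φ₀ (lab q y)|) := by ring
    _ ≤ 16384 * N := by linarith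

theorem abs_vort_le {φ₀ : ℝ → ℝ} {N : ℝ} (hN : ∀ η, (1 + |η|) * |φ₀ η| ≤ N) (y : ℝ) :
    |vort φ₀ q y| ≤ 16384 * N := by
  have := h.weighted_vort_le hN y
  nlinarith [abs_nonneg y, abs_nonneg (vort φ₀ q y)]

theorem green_vort (φ₀ : ℝ → ℝ) (y : ℝ) : green (vort φ₀ q) y
    = 1 / 2 * ∫ η, Real.exp (-|y - pos q η|) * (dens φ₀ q η * q η) := by
  rw [green, ← h.integral_comp_pos]
  congr 2
  ext η
  rw [h.vort_pos, mul_assoc]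

/-- Since positions are increasing in the label, the side of the kernel is decided by the labels. -/
theorem greenD_vort_pos (φ₀ : ℝ → ℝ) (η : ℝ) : greenD (vort φ₀ q) (pos q η)
    = 1 / 2 * ∫ ξ, (if ξ ≤ η then (-1 : ℝ) else 1) *
      (Real.exp (-|pos q η - pos q ξ|) * (dens φ₀ q ξ * q ξ)) := by
  rw [greenD, ← h.integral_comp_pos]
  congr 2
  ext ξ
  simp only [h.vort_pos, h.strictMono_pos.le_iff_le]
  ring

theorem continuous_vel {φ₀ : ℝ → ℝ} (hφ : Continuous φ₀) {N : ℝ}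
    (hN : ∀ η, (1 + |η|) * |φ₀ η| ≤ N) : Continuous (vel φ₀ q) :=
  h.cont.mul (((continuous_green (h.continuous_vort hφ) (h.abs_vort_le hN)).comp
    h.continuous_pos).add (h.continuous_pos.mul
    ((continuous_greenD (h.continuous_vort hφ) (h.abs_vort_le hN)).comp h.continuous_pos)))

theorem abs_weight_le (φ₀ : ℝ → ℝ) (η : ℝ) : |dens φ₀ q η * q η| ≤ 16384 * |φ₀ η| := by
  rw [abs_mul, abs_of_pos (h.q_pos η)]
  have := h.abs_dens_le φ₀ η
  nlinarith [h.upper η, h.q_pos η, abs_nonneg (dens φ₀ q η)]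

end

section Difference

variable {q₁ q₂ : ℝ → ℝ} (h₁ : Adm q₁) (h₂ : Adm q₂) {D : ℝ} (hD : ∀ η, |q₁ η - q₂ η| ≤ D)
include h₁ h₂ hD

theorem abs_avg_sub_le (η : ℝ) : |avg q₁ η - avg q₂ η| ≤ D := by
  have c1 : Continuous fun s => q₁ (s * η) := h₁.cont.comp (by fun_prop)
  have c2 : Continuous fun s => q₂ (s * η) := h₂.cont.comp (by fun_prop)
  rw [avg, avg, ← intervalIntegral.integral_sub (c1.intervalIntegrable _ _)
    (c2.intervalIntegrable _ _)]
  simpa using intervalIntegral.norm_integral_le_of_norm_le_const (a := 0) (b := 1) (C := D)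
    (f := fun s => q₁ (s * η) - q₂ (s * η)) (fun s _ => hD _)

theorem abs_pos_sub_sub_le (a b : ℝ) :
    |(pos q₁ a - pos q₁ b) - (pos q₂ a - pos q₂ b)| ≤ D * |a - b| := by
  rw [h₁.pos_sub, h₂.pos_sub, ← intervalIntegral.integral_sub (h₁.cont.intervalIntegrable _ _)
    (h₂.cont.intervalIntegrable _ _)]
  exact intervalIntegral.norm_integral_le_of_norm_le_const (a := b) (b := a) (C := D)
    (f := fun s => q₁ s - q₂ s) (fun s _ => hD _)

theorem abs_pos_sub_pos_le (a : ℝ) : |pos q₁ a - pos q₂ a| ≤ D * |a| := by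
  simpa [pos_zero] using abs_pos_sub_sub_le h₁ h₂ hD a 0

/-- The carried mass `φ(Y) Y_η = φ₀ q² / A⁵` is Lipschitz in `q`, by the bounds `q, A⁻¹ ≤ 4`. -/
theorem abs_weight_sub_le (φ₀ : ℝ → ℝ) (η : ℝ) :
    |dens φ₀ q₁ η * q₁ η - dens φ₀ q₂ η * q₂ η| ≤ 335872 * D * |φ₀ η| := by
  have hA := abs_avg_sub_le h₁ h₂ hD η
  have hD0 : 0 ≤ D := (abs_nonneg _).trans (hD η)
  set A := avg q₁ η
  set B := avg q₂ η
  have hA0 : 0 < A := h₁.avg_pos η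
  have hB0 : 0 < B := h₂.avg_pos η
  have hAi : A⁻¹ ≤ 4 := by
    rw [inv_le_comm₀ hA0 (by norm_num)]; have := h₁.lower_avg η; norm_num at this ⊢; exact this
  have hBi : B⁻¹ ≤ 4 := by
    rw [inv_le_comm₀ hB0 (by norm_num)]; have := h₂.lower_avg η; norm_num at this ⊢; exact this
  have hi : |A⁻¹ - B⁻¹| ≤ 16 * D := by
    rw [show A⁻¹ - B⁻¹ = A⁻¹ * B⁻¹ * (B - A) by field_simp, abs_mul,
      abs_of_pos (mul_pos (inv_pos.2 hA0) (inv_pos.2 hB0)), abs_sub_comm]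
    exact mul_le_mul (by nlinarith [inv_pos.2 hA0, inv_pos.2 hB0]) hA (abs_nonneg _) (by norm_num)
  set a := A⁻¹
  set b := B⁻¹
  have ha0 : 0 < a := inv_pos.2 hA0
  have hb0 : 0 < b := inv_pos.2 hB0
  have h5 : |a ^ 5 - b ^ 5| ≤ 20480 * D := by
    rw [show a ^ 5 - b ^ 5 = (a ^ 4 + a ^ 3 * b + a ^ 2 * b ^ 2 + a * b ^ 3 + b ^ 4) * (a - b) by ring,
      abs_mul, abs_of_pos (by positivity)]
    have : a ^ 4 + a ^ 3 * b + a ^ 2 * b ^ 2 + a * b ^ 3 + b ^ 4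
        ≤ 4 ^ 4 + 4 ^ 3 * 4 + 4 ^ 2 * 4 ^ 2 + 4 * 4 ^ 3 + 4 ^ 4 := by gcongr
    calc _ ≤ (1280 : ℝ) * (16 * D) :=
          mul_le_mul (by linarith) hi (abs_nonneg _) (by norm_num)
      _ = 20480 * D := by ring
  have hq : |q₁ η ^ 2 - q₂ η ^ 2| ≤ 8 * D := by
    rw [sq_sub_sq, abs_mul, abs_of_pos (add_pos (h₁.q_pos η) (h₂.q_pos η))]
    exact mul_le_mul (by linarith [h₁.upper η, h₂.upper η]) (hD η) (abs_nonneg _) (by norm_num)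
  have e : dens φ₀ q₁ η * q₁ η - dens φ₀ q₂ η * q₂ η
      = φ₀ η * ((q₁ η ^ 2 - q₂ η ^ 2) * a ^ 5 + q₂ η ^ 2 * (a ^ 5 - b ^ 5)) := by
    simp only [dens, a, b, A, B, inv_pow, div_eq_mul_inv]; ring
  rw [e, abs_mul, mul_comm]
  refine mul_le_mul_of_nonneg_right ((abs_add_le _ _).trans ?_) (abs_nonneg _)
  have e1 : |(q₁ η ^ 2 - q₂ η ^ 2) * a ^ 5| ≤ 8 * D * 4 ^ 5 := by
    rw [abs_mul, abs_of_pos (pow_pos ha0 5)]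
    exact mul_le_mul hq (by gcongr) (by positivity) (by positivity)
  have e2 : |q₂ η ^ 2 * (a ^ 5 - b ^ 5)| ≤ 4 ^ 2 * (20480 * D) := by
    rw [abs_mul, abs_of_pos (pow_pos (h₂.q_pos η) 2)]
    exact mul_le_mul (pow_le_pow_left₀ (h₂.q_pos η).le (h₂.upper η) 2) h5 (abs_nonneg _) (by positivity)
  linarith

end Difference

end Adm

/-- Lipschitz bound for `exp (-a) v` when the exponents are at least `r`. -/
theorem abs_exp_mul_sub_le {a b r v w : ℝ} (ha : r ≤ a) (hb : r ≤ b) :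
    |Real.exp (-a) * v - Real.exp (-b) * w| ≤ Real.exp (-r) * (|a - b| * |v| + |v - w|) := by
  have key : ∀ a b : ℝ, r ≤ a → a ≤ b → Real.exp (-a) - Real.exp (-b) ≤ Real.exp (-r) * (b - a) := by
    intro a b ha hab
    have h1 : 1 - (b - a) ≤ Real.exp (-(b - a)) := by
      have := Real.add_one_le_exp (-(b - a)); linarith
    have h2 : Real.exp (-b) = Real.exp (-a) * Real.exp (-(b - a)) := by
      rw [← Real.exp_add]; ring_nf
    have h3 : Real.exp (-a) ≤ Real.exp (-r) := Real.exp_le_exp.2 (by linarith)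
    have h4 := Real.exp_pos (-a)
    rw [h2]
    nlinarith
  have hexp : |Real.exp (-a) - Real.exp (-b)| ≤ Real.exp (-r) * |a - b| := by
    rcases le_total a b with hab | hab
    · rw [abs_of_nonneg (sub_nonneg.2 (Real.exp_le_exp.2 (by linarith))), abs_sub_comm,
        abs_of_nonneg (sub_nonneg.2 hab)]
      exact key a b ha hab
    · rw [abs_sub_comm, abs_of_nonneg (sub_nonneg.2 (Real.exp_le_exp.2 (by linarith))),
        abs_of_nonneg (sub_nonneg.2 hab)]
      exact key b a hb hab
  have hb' : Real.exp (-b) ≤ Real.exp (-r) := Real.exp_le_exp.2 (by linarith)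
  calc |Real.exp (-a) * v - Real.exp (-b) * w|
      = |(Real.exp (-a) - Real.exp (-b)) * v + Real.exp (-b) * (v - w)| := by ring_nf
    _ ≤ |Real.exp (-a) - Real.exp (-b)| * |v| + Real.exp (-b) * |v - w| := by
        refine (abs_add_le _ _).trans_eq ?_
        rw [abs_mul, abs_mul, Real.abs_exp]
    _ ≤ Real.exp (-r) * |a - b| * |v| + Real.exp (-r) * |v - w| := by gcongr
    _ = _ := by ring

theorem integrable_sq_mul_exp : Integrable fun z : ℝ => (1 + |z|) ^ 2 * Real.exp (-(|z| / 4)) := by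
  have h := (integrable_exp_neg_abs.comp_mul_left' (R := 1 / 8) (by norm_num)).const_mul 256
  refine h.mono' (by fun_prop) (Eventually.of_forall fun z => ?_)
  rw [Real.norm_eq_abs, abs_of_nonneg (by positivity)]
  -- One eighth of the exponential rate is spent on the factor `(1 + |z|)²`.
  have h1 : 1 + |z| ≤ 16 * Real.exp (|z| / 16) := by
    have := Real.add_one_le_exp (|z| / 16); linarith [abs_nonneg z]
  have h2 : (1 + |z|) ^ 2 ≤ 256 * Real.exp (|z| / 8) := by
    calc (1 + |z|) ^ 2 ≤ (16 * Real.exp (|z| / 16)) ^ 2 := by gcongr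
      _ = 256 * Real.exp (|z| / 8) := by
        rw [mul_pow, ← Real.exp_nat_mul]; norm_num; ring_nf
  calc _ ≤ 256 * Real.exp (|z| / 8) * Real.exp (-(|z| / 4)) := by gcongr
    _ = _ := by
      rw [mul_assoc, ← Real.exp_add, abs_mul]; norm_num; ring_nf

/-- The constant `∫ (1 + |z|)² exp (-|z|/4) dz`. -/
noncomputable def kerMass : ℝ := ∫ z : ℝ, (1 + |z|) ^ 2 * Real.exp (-(|z| / 4))

theorem kerMass_nonneg : 0 ≤ kerMass := integral_nonneg fun z => by positivity

/-- An integral whose kernel decays like `(1 + |η - ξ|) exp (-|η - ξ|/4)` against a weight that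
decays like `1/|ξ|` decays like `1/|η|`. -/
theorem weighted_integral_le {k φ₀ : ℝ → ℝ} {N c η : ℝ} (hc : 0 ≤ c)
    (hN : ∀ η, (1 + |η|) * |φ₀ η| ≤ N)
    (hk : ∀ ξ, |k ξ| ≤ c * ((1 + |η - ξ|) * Real.exp (-(|η - ξ| / 4)) * |φ₀ ξ|)) :
    (1 + |η|) * |1 / 2 * ∫ ξ, k ξ| ≤ c * N * kerMass := by
  have hN0 : 0 ≤ N := le_trans (by positivity) (hN 0)
  have hb : ∀ ξ, ‖(1 + |η|) * k ξ‖
      ≤ (c * N) * ((1 + |η - ξ|) ^ 2 * Real.exp (-(|η - ξ| / 4))) := fun ξ => by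
    have h1 : 1 + |η| ≤ (1 + |η - ξ|) * (1 + |ξ|) := by
      have : |η| ≤ |η - ξ| + |ξ| := by simpa using abs_add_le (η - ξ) ξ
      nlinarith [abs_nonneg (η - ξ), abs_nonneg ξ]
    rw [norm_mul, Real.norm_eq_abs, Real.norm_eq_abs, abs_of_nonneg (by positivity : 0 ≤ 1 + |η|)]
    calc (1 + |η|) * |k ξ| ≤ ((1 + |η - ξ|) * (1 + |ξ|)) *
          (c * ((1 + |η - ξ|) * Real.exp (-(|η - ξ| / 4)) * |φ₀ ξ|)) :=
          mul_le_mul h1 (hk ξ) (abs_nonneg _) (by positivity)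
      _ = c * ((1 + |η - ξ|) ^ 2 * Real.exp (-(|η - ξ| / 4))) * ((1 + |ξ|) * |φ₀ ξ|) := by ring
      _ ≤ c * ((1 + |η - ξ|) ^ 2 * Real.exp (-(|η - ξ| / 4))) * N := by
          gcongr; exact hN ξ
      _ = _ := by ring
  have := norm_integral_le_of_norm_le
    ((integrable_sq_mul_exp.comp_sub_left η).const_mul (c * N)) (Eventually.of_forall hb)
  rw [integral_const_mul, integral_const_mul,
    integral_sub_left_eq_self (fun z => (1 + |z|) ^ 2 * Real.exp (-(|z| / 4))) volume η,
    norm_mul, Real.norm_eq_abs, Real.norm_eq_abs, abs_of_nonneg (by positivity : 0 ≤ 1 + |η|)] at this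
  rw [abs_mul, abs_of_pos (by norm_num : (0:ℝ) < 1 / 2)]
  have h0 : 0 ≤ (1 + |η|) * |∫ ξ, k ξ| := by positivity
  change _ ≤ c * N * kerMass at this
  linarith

/-! ### Boundedness and Lipschitz continuity of the vector field -/

namespace Adm

section Bounds

variable {φ₀ : ℝ → ℝ} (hφ : Continuous φ₀) {N : ℝ} (hN : ∀ η, (1 + |η|) * |φ₀ η| ≤ N)

theorem abs_kernel_le {q : ℝ → ℝ} (h : Adm q) (φ₀ : ℝ → ℝ) (η ξ : ℝ) :
    |Real.exp (-|pos q η - pos q ξ|) * (dens φ₀ q ξ * q ξ)|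
      ≤ 16384 * ((1 + |η - ξ|) * Real.exp (-(|η - ξ| / 4)) * |φ₀ ξ|) := by
  rw [abs_mul, Real.abs_exp]
  have h1 : Real.exp (-|pos q η - pos q ξ|) ≤ Real.exp (-(|η - ξ| / 4)) :=
    Real.exp_le_exp.2 (neg_le_neg (h.le_abs_pos_sub η ξ))
  have h2 := h.abs_weight_le φ₀ ξ
  calc _ ≤ Real.exp (-(|η - ξ| / 4)) * (16384 * |φ₀ ξ|) := by gcongr
    _ = 16384 * (1 * Real.exp (-(|η - ξ| / 4)) * |φ₀ ξ|) := by ring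
    _ ≤ _ := by gcongr; linarith [abs_nonneg (η - ξ)]

theorem abs_kernel_sub_le {q₁ q₂ : ℝ → ℝ} (h₁ : Adm q₁) (h₂ : Adm q₂) {D : ℝ}
    (hD : ∀ η, |q₁ η - q₂ η| ≤ D) (φ₀ : ℝ → ℝ) (η ξ : ℝ) :
    |Real.exp (-|pos q₁ η - pos q₁ ξ|) * (dens φ₀ q₁ ξ * q₁ ξ)
      - Real.exp (-|pos q₂ η - pos q₂ ξ|) * (dens φ₀ q₂ ξ * q₂ ξ)|
      ≤ 335872 * D * ((1 + |η - ξ|) * Real.exp (-(|η - ξ| / 4)) * |φ₀ ξ|) := by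
  have hD0 : 0 ≤ D := (abs_nonneg _).trans (hD 0)
  refine (abs_exp_mul_sub_le (h₁.le_abs_pos_sub η ξ) (h₂.le_abs_pos_sub η ξ)).trans ?_
  have e1 : |(|pos q₁ η - pos q₁ ξ| - |pos q₂ η - pos q₂ ξ|)| ≤ D * |η - ξ| :=
    (abs_abs_sub_abs_le_abs_sub _ _).trans (abs_pos_sub_sub_le h₁ h₂ hD η ξ)
  have e2 := h₁.abs_weight_le φ₀ ξ
  have e3 := abs_weight_sub_le h₁ h₂ hD φ₀ ξ
  calc _ ≤ Real.exp (-(|η - ξ| / 4)) * (D * |η - ξ| * (16384 * |φ₀ ξ|) + 335872 * D * |φ₀ ξ|) := by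
        gcongr
    _ = 335872 * D * ((1 + 16384 / 335872 * |η - ξ|) * Real.exp (-(|η - ξ| / 4)) * |φ₀ ξ|) := by ring
    _ ≤ _ := by
        gcongr
        exact mul_le_of_le_one_left (abs_nonneg _) (by norm_num)

include hN

theorem weighted_green_le {q : ℝ → ℝ} (h : Adm q) (η : ℝ) :
    (1 + |η|) * |green (vort φ₀ q) (pos q η)| ≤ 16384 * N * kerMass := by
  rw [h.green_vort]
  exact weighted_integral_le (by norm_num) hN (h.abs_kernel_le φ₀ η)

theorem weighted_greenD_le {q : ℝ → ℝ} (h : Adm q) (η : ℝ) :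
    (1 + |η|) * |greenD (vort φ₀ q) (pos q η)| ≤ 16384 * N * kerMass := by
  rw [h.greenD_vort_pos]
  refine weighted_integral_le (by norm_num) hN fun ξ => ?_
  rw [abs_mul, abs_side, one_mul]
  exact h.abs_kernel_le φ₀ η ξ

/-- The vector field of the equation for the stretching is bounded. -/
theorem abs_vel_le {q : ℝ → ℝ} (h : Adm q) (η : ℝ) :
    |vel φ₀ q η| ≤ 20 * (335872 * N * kerMass) := by
  have hN0 : 0 ≤ N := le_trans (by positivity) (hN 0)
  have hK := kerMass_nonneg
  have hNK : 0 ≤ N * kerMass := mul_nonneg hN0 hK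
  have e1 := weighted_green_le hN h η
  have e2 := weighted_greenD_le hN h η
  set G := green (vort φ₀ q) (pos q η)
  set H := greenD (vort φ₀ q) (pos q η)
  have e3 := h.abs_pos_le η
  have g1 : |G| ≤ 335872 * N * kerMass := by nlinarith [abs_nonneg η, abs_nonneg G]
  have g2 : |pos q η * H| ≤ 4 * (335872 * N * kerMass) := by
    rw [abs_mul]
    calc |pos q η| * |H| ≤ 4 * |η| * |H| := by gcongr
      _ ≤ 4 * ((1 + |η|) * |H|) := by nlinarith [abs_nonneg H]
      _ ≤ _ := by nlinarith
  rw [vel, abs_mul, abs_of_pos (h.q_pos η)]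
  calc q η * |G + pos q η * H| ≤ 4 * (335872 * N * kerMass + 4 * (335872 * N * kerMass)) :=
        mul_le_mul (h.upper η) ((abs_add_le _ _).trans (add_le_add g1 g2)) (abs_nonneg _) (by norm_num)
    _ = _ := by ring

include hφ

theorem integrable_kernel {q : ℝ → ℝ} (h : Adm q) (y : ℝ) :
    Integrable fun ξ => Real.exp (-|y - pos q ξ|) * (dens φ₀ q ξ * q ξ) := by
  have hc : Continuous fun ξ => Real.exp (-|y - pos q ξ|) * (dens φ₀ q ξ * q ξ) := by
    have := h.continuous_pos
    have := h.continuous_dens hφ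
    have := h.cont
    fun_prop
  obtain ⟨η, rfl⟩ := h.surjective_pos y
  refine ((integrable_sq_mul_exp.comp_sub_left η).const_mul (16384 * N)).mono'
    hc.aestronglyMeasurable (Eventually.of_forall fun ξ => (h.abs_kernel_le φ₀ η ξ).trans ?_)
  have h1 : |φ₀ ξ| ≤ N := by
    have := hN ξ; nlinarith [abs_nonneg ξ, abs_nonneg (φ₀ ξ)]
  have hN0 : 0 ≤ N := (abs_nonneg _).trans h1
  have h2 : 1 + |η - ξ| ≤ (1 + |η - ξ|) ^ 2 := by nlinarith [abs_nonneg (η - ξ)]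
  calc _ ≤ 16384 * ((1 + |η - ξ|) ^ 2 * Real.exp (-(|η - ξ| / 4)) * N) := by gcongr
    _ = _ := by ring

theorem weighted_green_sub_le {q₁ q₂ : ℝ → ℝ} (h₁ : Adm q₁) (h₂ : Adm q₂) {D : ℝ}
    (hD : ∀ η, |q₁ η - q₂ η| ≤ D) (η : ℝ) :
    (1 + |η|) * |green (vort φ₀ q₁) (pos q₁ η) - green (vort φ₀ q₂) (pos q₂ η)|
      ≤ 335872 * D * N * kerMass := by
  have hD0 : 0 ≤ D := (abs_nonneg _).trans (hD 0)
  rw [h₁.green_vort, h₂.green_vort, ← mul_sub, ← integral_sub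
    (integrable_kernel hφ hN h₁ _) (integrable_kernel hφ hN h₂ _)]
  exact weighted_integral_le (by positivity) hN (abs_kernel_sub_le h₁ h₂ hD φ₀ η)

theorem weighted_greenD_sub_le {q₁ q₂ : ℝ → ℝ} (h₁ : Adm q₁) (h₂ : Adm q₂) {D : ℝ}
    (hD : ∀ η, |q₁ η - q₂ η| ≤ D) (η : ℝ) :
    (1 + |η|) * |greenD (vort φ₀ q₁) (pos q₁ η) - greenD (vort φ₀ q₂) (pos q₂ η)|
      ≤ 335872 * D * N * kerMass := by
  have hD0 : 0 ≤ D := (abs_nonneg _).trans (hD 0)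
  have hi : ∀ {q : ℝ → ℝ}, Adm q → Integrable fun ξ => (if ξ ≤ η then (-1 : ℝ) else 1) *
      (Real.exp (-|pos q η - pos q ξ|) * (dens φ₀ q ξ * q ξ)) := fun h =>
    (integrable_kernel hφ hN h _).bdd_mul (c := 1) (measurable_side η).aestronglyMeasurable
      (Eventually.of_forall fun x => (abs_side x η).le)
  rw [h₁.greenD_vort_pos, h₂.greenD_vort_pos, ← mul_sub, ← integral_sub (hi h₁) (hi h₂)]
  refine weighted_integral_le (by positivity) hN fun ξ => ?_
  rw [← mul_sub, abs_mul, abs_side, one_mul]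
  exact abs_kernel_sub_le h₁ h₂ hD φ₀ η ξ

/-- The vector field of the equation for the stretching is Lipschitz in the supremum norm. -/
theorem abs_vel_sub_le {q₁ q₂ : ℝ → ℝ} (h₁ : Adm q₁) (h₂ : Adm q₂) {D : ℝ}
    (hD : ∀ η, |q₁ η - q₂ η| ≤ D) (η : ℝ) :
    |vel φ₀ q₁ η - vel φ₀ q₂ η| ≤ 29 * (335872 * N * kerMass) * D := by
  have hD0 : 0 ≤ D := (abs_nonneg _).trans (hD 0)
  have hN0 : 0 ≤ N := le_trans (by positivity) (hN 0)
  have hK := kerMass_nonneg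
  have hNK : 0 ≤ N * kerMass := mul_nonneg hN0 hK
  have e1 := weighted_green_le hN h₁ η
  have e2 := weighted_greenD_le hN h₁ η
  have e3 := weighted_green_sub_le hφ hN h₁ h₂ hD η
  have e4 := weighted_greenD_sub_le hφ hN h₁ h₂ hD η
  have p1 := h₁.abs_pos_le η
  have p2 := h₂.abs_pos_le η
  have p3 := abs_pos_sub_pos_le h₁ h₂ hD η
  set G₁ := green (vort φ₀ q₁) (pos q₁ η)
  set H₁ := greenD (vort φ₀ q₁) (pos q₁ η)
  set G₂ := green (vort φ₀ q₂) (pos q₂ η)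
  set H₂ := greenD (vort φ₀ q₂) (pos q₂ η)
  set B := 335872 * N * kerMass with hB
  have hB0 : 0 ≤ B := by positivity
  have hη := abs_nonneg η
  have g1 : |G₁| ≤ B := by nlinarith [abs_nonneg G₁]
  have w2 : |η| * |H₁| ≤ B := by nlinarith [abs_nonneg H₁]
  have w3 : |G₁ - G₂| ≤ B * D := by nlinarith [abs_nonneg (G₁ - G₂)]
  have w4 : |η| * |H₁ - H₂| ≤ B * D := by nlinarith [abs_nonneg (H₁ - H₂)]
  have g2 : |pos q₁ η * H₁| ≤ 4 * B := by
    rw [abs_mul]; nlinarith [abs_nonneg H₁]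
  have g3 : |(pos q₁ η - pos q₂ η) * H₁| ≤ B * D := by
    rw [abs_mul]
    calc _ ≤ D * |η| * |H₁| := by gcongr
      _ = D * (|η| * |H₁|) := by ring
      _ ≤ D * B := by gcongr
      _ = _ := mul_comm _ _
  have g4 : |pos q₂ η * (H₁ - H₂)| ≤ 4 * (B * D) := by
    rw [abs_mul]; nlinarith [abs_nonneg (H₁ - H₂)]
  have e : vel φ₀ q₁ η - vel φ₀ q₂ η = (q₁ η - q₂ η) * (G₁ + pos q₁ η * H₁)
      + q₂ η * ((G₁ - G₂) + ((pos q₁ η - pos q₂ η) * H₁ + pos q₂ η * (H₁ - H₂))) := by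
    simp only [vel, G₁, G₂, H₁, H₂]; ring
  rw [e]
  refine (abs_add_le _ _).trans ?_
  rw [abs_mul, abs_mul, abs_of_pos (h₂.q_pos η)]
  have f1 : |q₁ η - q₂ η| * |G₁ + pos q₁ η * H₁| ≤ D * (B + 4 * B) :=
    mul_le_mul (hD η) ((abs_add_le _ _).trans (add_le_add g1 g2)) (abs_nonneg _) hD0
  have f2 : q₂ η * |(G₁ - G₂) + ((pos q₁ η - pos q₂ η) * H₁ + pos q₂ η * (H₁ - H₂))|
      ≤ 4 * (B * D + (B * D + 4 * (B * D))) :=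
    mul_le_mul (h₂.upper η) ((abs_add_le _ _).trans (add_le_add w3
      ((abs_add_le _ _).trans (add_le_add g3 g4)))) (abs_nonneg _) (by norm_num)
  linarith

end Bounds

end Adm

/-! ### The equation for the stretching as an ordinary differential equation -/

/-- A path of stretchings that solves `q_t = Y_η (g + Y g_y)` on `(-T, T)`, with the initial value
`1` and values in `[1/2, 3/2]`. It is defined for all times; only the equation is confined to
`(-T, T)`. -/
structure IsPath (φ₀ : ℝ → ℝ) (T L : ℝ) (Q : ℝ → ℝ → ℝ) : Prop where
  cont : Continuous (Function.uncurry Q)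
  lower : ∀ t η, 1 / 2 ≤ Q t η
  upper : ∀ t η, Q t η ≤ 3 / 2
  lip : ∀ s t η, |Q s η - Q t η| ≤ L * |s - t|
  hasDerivAt : ∀ t ∈ Ioo (-T) T, ∀ η, HasDerivAt (fun s => Q s η) (vel φ₀ (Q t) η) t
  init : ∀ η, Q 0 η = 1

/-- Picard–Lindelöf in the space of bounded continuous functions. -/
theorem exists_isPath {φ₀ : ℝ → ℝ} (hφ : Continuous φ₀) {N : ℝ}
    (hN : ∀ η, (1 + |η|) * |φ₀ η| ≤ N) : ∃ T > 0, ∃ L, ∃ Q, IsPath φ₀ T L Q := by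
  have hN0 : 0 ≤ N := le_trans (by positivity) (hN 0)
  have hK := kerMass_nonneg
  have hB : 0 ≤ 335872 * N * kerMass := by positivity
  -- The vector field as a map of the space; its values at other `q` are irrelevant.
  have hex : ∀ q : BoundedContinuousFunction ℝ ℝ, ∃ V : BoundedContinuousFunction ℝ ℝ,
      Adm q → ∀ η, V η = vel φ₀ q η := fun q => by
    by_cases h : Adm q
    · exact ⟨BoundedContinuousFunction.ofNormedAddCommGroup (vel φ₀ q) (h.continuous_vel hφ hN) _
        (fun η => h.abs_vel_le hN η), fun _ η => rfl⟩
    · exact ⟨0, fun h' => (h h').elim⟩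
  choose F hF using hex
  have hball : ∀ q ∈ Metric.closedBall (1 : BoundedContinuousFunction ℝ ℝ) (1 / 2 : ℝ), ∀ η,
      1 / 2 ≤ q η ∧ q η ≤ 3 / 2 := fun q hq η => by
    have h1 : |q η - 1| ≤ 1 / 2 := by
      have := (BoundedContinuousFunction.dist_coe_le_dist (f := q) (g := 1) η).trans
        (Metric.mem_closedBall.1 hq)
      simpa [Real.dist_eq] using this
    rw [abs_le] at h1
    constructor <;> linarith
  have hadm : ∀ q ∈ Metric.closedBall (1 : BoundedContinuousFunction ℝ ℝ) (1 / 2 : ℝ), Adm q :=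
    fun q hq => ⟨q.continuous, fun η => by linarith [(hball q hq η).1],
      fun η => by linarith [(hball q hq η).2]⟩
  set B : NNReal := ⟨335872 * N * kerMass, hB⟩ with hBdef
  set T : ℝ := 1 / (2 * (20 * B + 1)) with hT
  have hT0 : 0 < T := by positivity
  have h0 : (0 : ℝ) ∈ Icc (-T) T := ⟨by linarith, hT0.le⟩
  have hpl : IsPicardLindelof (fun _ : ℝ => F) (⟨0, h0⟩ : Icc (-T) T) 1 (1 / 2) 0 (20 * B)
      (29 * B) := by
    refine IsPicardLindelof.of_time_independent (fun q hq => ?_) ?_ ?_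
    · rw [NNReal.coe_div, NNReal.coe_one, NNReal.coe_ofNat] at hq
      refine (BoundedContinuousFunction.norm_le (by positivity)).2 fun η => ?_
      rw [hF q (hadm q hq) η]
      exact (hadm q hq).abs_vel_le hN η
    · refine LipschitzOnWith.of_dist_le_mul fun p hp q hq => ?_
      rw [NNReal.coe_div, NNReal.coe_one, NNReal.coe_ofNat] at hp hq
      refine (BoundedContinuousFunction.dist_le (by positivity)).2 fun η => ?_
      rw [hF q (hadm q hq) η, hF p (hadm p hp) η]
      exact Adm.abs_vel_sub_le hφ hN (hadm p hp) (hadm q hq)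
        (fun η => BoundedContinuousFunction.dist_coe_le_dist (f := p) (g := q) η) η
    · simp only [sub_zero, zero_sub, neg_neg, max_self, NNReal.coe_mul, NNReal.coe_ofNat,
        NNReal.coe_div, NNReal.coe_one, NNReal.coe_zero]
      have hB' : (0:ℝ) ≤ B := B.2
      rw [hT, mul_one_div, div_le_iff₀ (by positivity)]
      linarith
  have hx : (1 : BoundedContinuousFunction ℝ ℝ) ∈ Metric.closedBall 1 ((0 : NNReal) : ℝ) :=
    Metric.mem_closedBall_self le_rfl
  obtain ⟨α, hα⟩ := ODE.FunSpace.exists_isFixedPt_next hpl hx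
  have hmem : ∀ t, α.compProj t ∈ Metric.closedBall (1 : BoundedContinuousFunction ℝ ℝ) (1 / 2 : ℝ) :=
    fun t => by
      have := α.compProj_mem_closedBall (t := t) hpl.mul_max_le
      simpa using this
  -- The fixed point is used directly, because it is also known to stay in the ball at all times.
  have hder : ∀ t ∈ Icc (-T) T, HasDerivWithinAt α.compProj (F (α.compProj t)) (Icc (-T) T) t := by
    intro t ht
    have h1 := ODE.hasDerivWithinAt_picard_Icc h0 hpl.continuousOn_uncurry
      α.continuous_compProj.continuousOn
      (fun _ _ => α.compProj_mem_closedBall hpl.mul_max_le) 1 ht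
    refine h1.congr_of_mem (fun s hs => ?_) ht
    nth_rw 1 [← hα]
    rw [ODE.FunSpace.compProj_of_mem hs, ODE.FunSpace.next_apply]
  have hlip : LipschitzWith (20 * B) α.compProj := by
    have := α.lipschitzWith.comp (LipschitzWith.projIcc (a := -T) (b := T) (by linarith))
    rwa [mul_one] at this
  refine ⟨T, hT0, ((20 * B : NNReal) : ℝ), fun t => α.compProj t, ?_, ?_, ?_, ?_, ?_, ?_⟩
  · exact continuous_eval.comp
      ((α.continuous_compProj.comp continuous_fst).prodMk continuous_snd)
  · exact fun t η => (hball _ (hmem t) η).1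
  · exact fun t η => (hball _ (hmem t) η).2
  · exact fun s t η => (BoundedContinuousFunction.dist_coe_le_dist
      (f := α.compProj s) (g := α.compProj t) η).trans (hlip.dist_le_mul s t)
  · intro t ht η
    have h1 := (hder t (Ioo_subset_Icc_self ht)).hasDerivAt (Icc_mem_nhds ht.1 ht.2)
    have h2 := (BoundedContinuousFunction.evalCLM ℝ η).hasFDerivAt.comp_hasDerivAt t h1
    rw [← hF _ (hadm _ (hmem t)) η]
    exact h2
  · intro η
    have h1 : α.compProj 0 = 1 := by
      rw [ODE.FunSpace.compProj_of_mem h0, ← hα, ODE.FunSpace.next_apply₀]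
    simp only [h1]; rfl

/-! ### From the stretching to a solution -/

/-- The flux `u φ` of `φ`, where `u = y g`. -/
noncomputable def flux (φ₀ q : ℝ → ℝ) (x : ℝ) : ℝ := x * green (vort φ₀ q) x * vort φ₀ q x

/-- The source `(2 u_y - 5 g) φ = (2 y g_y - 3 g) φ` in `φ_t + (u φ)_y = (2 u_y - 5 g) φ`. -/
noncomputable def source (φ₀ q : ℝ → ℝ) (x : ℝ) : ℝ :=
  (2 * x * greenD (vort φ₀ q) x - 3 * green (vort φ₀ q) x) * vort φ₀ q x

namespace Adm

variable {q : ℝ → ℝ} (h : Adm q)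
include h

/-- Particles move with the velocity `y g`: the position belonging to the stretching rate
`Y_η (g + Y g_y)` is `Y g(Y)`. -/
theorem integral_vel {φ₀ : ℝ → ℝ} (hφ : Continuous φ₀) {N : ℝ}
    (hN : ∀ η, (1 + |η|) * |φ₀ η| ≤ N) (η : ℝ) :
    ∫ x in (0 : ℝ)..η, vel φ₀ q x = pos q η * green (vort φ₀ q) (pos q η) := by
  have hd : ∀ x ∈ uIcc 0 η, HasDerivAt (fun x => pos q x * green (vort φ₀ q) (pos q x))
      (vel φ₀ q x) x := fun x _ =>
    ((h.hasDerivAt_pos x).mul ((hasDerivAt_green (h.continuous_vort hφ) (h.abs_vort_le hN)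
      (pos q x)).comp x (h.hasDerivAt_pos x))).congr_deriv (by simp only [vel, Function.comp_apply]; ring)
  rw [intervalIntegral.integral_eq_sub_of_hasDerivAt hd
    ((h.continuous_vel hφ hN).intervalIntegrable _ _), pos_zero]
  ring

theorem abs_mul_vort_le {φ₀ : ℝ → ℝ} {N : ℝ} (hN : ∀ η, (1 + |η|) * |φ₀ η| ≤ N) (x : ℝ) :
    |x| * |vort φ₀ q x| ≤ 16384 * N := by
  have := h.weighted_vort_le hN x
  nlinarith [abs_nonneg (vort φ₀ q x)]

theorem abs_flux_le {φ₀ : ℝ → ℝ} {N : ℝ} (hN : ∀ η, (1 + |η|) * |φ₀ η| ≤ N) (x : ℝ) :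
    |flux φ₀ q x| ≤ (16384 * N) ^ 2 := by
  have h1 := abs_green_le (h.abs_vort_le hN) x
  have h2 := h.abs_mul_vort_le hN x
  rw [flux, abs_mul, abs_mul, mul_right_comm, sq]
  exact mul_le_mul h2 h1 (abs_nonneg _) ((abs_nonneg _).trans h1)

theorem abs_source_le {φ₀ : ℝ → ℝ} {N : ℝ} (hN : ∀ η, (1 + |η|) * |φ₀ η| ≤ N) (x : ℝ) :
    |source φ₀ q x| ≤ 5 * (16384 * N) ^ 2 := by
  have h1 := abs_green_le (h.abs_vort_le hN) x
  have h2 := h.abs_mul_vort_le hN x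
  have h3 := abs_greenD_le (h.abs_vort_le hN) x
  have h4 := h.abs_vort_le hN x
  have h0 : 0 ≤ 16384 * N := (abs_nonneg _).trans h1
  have e : source φ₀ q x = 2 * (x * vort φ₀ q x * greenD (vort φ₀ q) x)
      - 3 * (green (vort φ₀ q) x * vort φ₀ q x) := by rw [source]; ring
  have e1 : |x * vort φ₀ q x * greenD (vort φ₀ q) x| ≤ (16384 * N) ^ 2 := by
    rw [abs_mul, abs_mul, sq]; exact mul_le_mul h2 h3 (abs_nonneg _) h0
  have e2 : |green (vort φ₀ q) x * vort φ₀ q x| ≤ (16384 * N) ^ 2 := by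
    rw [abs_mul, sq]; exact mul_le_mul h1 h4 (abs_nonneg _) h0
  rw [e]
  refine (abs_sub _ _).trans ?_
  rw [abs_mul (2 : ℝ), abs_mul (3 : ℝ), abs_two, abs_of_pos (by norm_num : (0:ℝ) < 3)]
  linarith

theorem continuous_flux {φ₀ : ℝ → ℝ} (hφ : Continuous φ₀) {N : ℝ}
    (hN : ∀ η, (1 + |η|) * |φ₀ η| ≤ N) : Continuous (flux φ₀ q) :=
  (continuous_id.mul (continuous_green (h.continuous_vort hφ) (h.abs_vort_le hN))).mul
    (h.continuous_vort hφ)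

theorem continuous_source {φ₀ : ℝ → ℝ} (hφ : Continuous φ₀) {N : ℝ}
    (hN : ∀ η, (1 + |η|) * |φ₀ η| ≤ N) : Continuous (source φ₀ q) :=
  (((continuous_const.mul continuous_id).mul
    (continuous_greenD (h.continuous_vort hφ) (h.abs_vort_le hN))).sub
    (continuous_const.mul (continuous_green (h.continuous_vort hφ) (h.abs_vort_le hN)))).mul
    (h.continuous_vort hφ)

end Adm

theorem continuous_uncurry_pos {Q : ℝ → ℝ → ℝ} (hQ : Continuous (Function.uncurry Q)) :
    Continuous fun p : ℝ × ℝ => pos (Q p.1) p.2 :=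
  intervalIntegral.continuous_parametric_intervalIntegral_of_continuous
    (f := fun (p : ℝ × ℝ) x => Q p.1 x) (hQ.comp (by fun_prop : Continuous fun z : (ℝ × ℝ) × ℝ =>
      (z.1.1, z.2))) continuous_snd

theorem continuous_uncurry_avg {Q : ℝ → ℝ → ℝ} (hQ : Continuous (Function.uncurry Q)) :
    Continuous fun p : ℝ × ℝ => avg (Q p.1) p.2 :=
  intervalIntegral.continuous_parametric_intervalIntegral_of_continuous'
    (f := fun (p : ℝ × ℝ) s => Q p.1 (s * p.2))
    (hQ.comp (by fun_prop : Continuous fun z : (ℝ × ℝ) × ℝ => (z.1.1, z.2 * z.1.2))) 0 1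

theorem continuous_uncurry_vort {Q : ℝ → ℝ → ℝ} (hQ : Continuous (Function.uncurry Q))
    (hA : ∀ t, Adm (Q t)) {φ₀ : ℝ → ℝ} (hφ : Continuous φ₀) :
    Continuous fun p : ℝ × ℝ => vort φ₀ (Q p.1) p.2 := by
  have hlab : Continuous fun p : ℝ × ℝ => lab (Q p.1) p.2 := by
    refine continuous_iff_continuousAt.2 fun p₀ => ?_
    have hpos : Continuous fun p : ℝ × ℝ => 4 * |p.2 - pos (Q p.1) (lab (Q p₀.1) p₀.2)| :=
      continuous_const.mul (continuous_snd.sub ((continuous_uncurry_pos hQ).comp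
        (continuous_fst.prodMk continuous_const))).abs
    have h0 := hpos.tendsto p₀
    simp only [(hA p₀.1).pos_lab, sub_self, abs_zero, mul_zero] at h0
    -- Positions separate labels by a factor `1/4`, uniformly in time.
    refine tendsto_iff_dist_tendsto_zero.2 (squeeze_zero (fun _ => dist_nonneg) (fun p => ?_) h0)
    have := (hA p.1).le_abs_pos_sub (lab (Q p.1) p.2) (lab (Q p₀.1) p₀.2)
    rw [(hA p.1).pos_lab] at this
    rw [Real.dist_eq]; linarith
  have hdens : Continuous fun p : ℝ × ℝ => dens φ₀ (Q p.1) p.2 :=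
    ((hφ.comp continuous_snd).mul hQ).div ((continuous_uncurry_avg hQ).pow 5)
      fun p => (pow_pos ((hA p.1).avg_pos p.2) 5).ne'
  exact hdens.comp (continuous_fst.prodMk hlab)

namespace IsPath

variable {φ₀ : ℝ → ℝ} {T L : ℝ} {Q : ℝ → ℝ → ℝ} (hQ : IsPath φ₀ T L Q)
include hQ

theorem adm (t : ℝ) : Adm (Q t) where
  cont := hQ.cont.comp (continuous_const.prodMk continuous_id)
  lower η := by linarith [hQ.lower t η]
  upper η := by linarith [hQ.upper t η]

theorem L_nonneg : 0 ≤ L := by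
  have := (abs_nonneg _).trans (hQ.lip 1 0 0)
  simpa using this

variable (hφ : Continuous φ₀) {N : ℝ} (hN : ∀ η, (1 + |η|) * |φ₀ η| ≤ N)
include hφ hN

theorem hasDerivAt_pos {t : ℝ} (ht : t ∈ Ioo (-T) T) (η : ℝ) :
    HasDerivAt (fun s => pos (Q s) η)
      (pos (Q t) η * green (vort φ₀ (Q t)) (pos (Q t) η)) t := by
  rw [← (hQ.adm t).integral_vel hφ hN]
  refine (intervalIntegral.hasDerivAt_integral_of_dominated_loc_of_lip (s := univ)
    (F := fun s x => Q s x) (bound := fun _ => L) univ_mem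
    (Eventually.of_forall fun s => (hQ.adm s).cont.aestronglyMeasurable)
    ((hQ.adm t).cont.intervalIntegrable _ _)
    ((hQ.adm t).continuous_vel hφ hN).aestronglyMeasurable
    (Eventually.of_forall fun x _ => ?_) (by simp)
    (Eventually.of_forall fun x _ => hQ.hasDerivAt t ht x)).2
  refine LipschitzOnWith.of_dist_le_mul fun a _ b _ => ?_
  simp only [Real.dist_eq, Real.coe_nnabs, abs_of_nonneg hQ.L_nonneg]
  exact hQ.lip a b x

/-- Time derivative of the mass `φ(Y) Y_η` carried by a particle. -/
theorem hasDerivAt_weight {t : ℝ} (ht : t ∈ Ioo (-T) T) {η : ℝ} (hη : η ≠ 0) :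
    HasDerivAt (fun s => dens φ₀ (Q s) η * Q s η)
      ((2 * pos (Q t) η * greenD (vort φ₀ (Q t)) (pos (Q t) η)
        - 3 * green (vort φ₀ (Q t)) (pos (Q t) η)) * (dens φ₀ (Q t) η * Q t η)) t := by
  -- `A = Y / η` inherits its evolution from `Y`; this is where `η ≠ 0` enters.
  have hA : ∀ s, avg (Q s) η = pos (Q s) η / η := fun s => by
    rw [pos_eq_mul_avg]; field_simp
  have h1 : HasDerivAt (fun s => avg (Q s) η)
      (avg (Q t) η * green (vort φ₀ (Q t)) (pos (Q t) η)) t := by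
    simp only [hA]
    exact ((hQ.hasDerivAt_pos hφ hN ht η).div_const η).congr_deriv (by ring)
  have h2 := hQ.hasDerivAt t ht η
  have h3 := (((h2.const_mul (φ₀ η)).div (h1.pow 5)
    (pow_pos ((hQ.adm t).avg_pos η) 5).ne')).mul h2
  refine h3.congr_deriv ?_
  have hne := ((hQ.adm t).avg_pos η).ne'
  simp only [dens, vel, Pi.pow_apply, Pi.div_apply]
  field_simp
  ring

/-- Time derivative of `½ ∫ exp (-|y - Y|) φ(Y) Y_η dη`, taken under the integral sign: the
integrand is differentiable except at the one label with `Y = y` and at `η = 0`. -/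
theorem hasDerivAt_green_vort {t : ℝ} (ht : t ∈ Ioo (-T) T) (y : ℝ) :
    HasDerivAt (fun s => green (vort φ₀ (Q s)) y)
      (green (source φ₀ (Q t)) y - greenD (flux φ₀ (Q t)) y) t := by
  have hN0 : 0 ≤ N := le_trans (by positivity) (hN 0)
  have hL := hQ.L_nonneg
  have hAt := hQ.adm t
  -- The derivative of the integrand in terms of the position `x = Y` of the particle.
  set G : ℝ → ℝ := fun x => Real.exp (-|y - x|) * source φ₀ (Q t) x
    - (if x ≤ y then (-1 : ℝ) else 1) * Real.exp (-|y - x|) * flux φ₀ (Q t) x with hG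
  have hval : 1 / 2 * ∫ η, G (pos (Q t) η) * Q t η
      = green (source φ₀ (Q t)) y - greenD (flux φ₀ (Q t)) y := by
    rw [hAt.integral_comp_pos, hG, integral_sub
      (integrable_green (hAt.continuous_source hφ hN) (hAt.abs_source_le hN) y)
      (integrable_greenD (hAt.continuous_flux hφ hN) (hAt.abs_flux_le hN) y), mul_sub]
    rfl
  have hmeas : Measurable G := by
    have c1 := (hAt.continuous_source hφ hN).measurable
    have c2 := (hAt.continuous_flux hφ hN).measurable
    have c3 : Measurable fun x : ℝ => Real.exp (-|y - x|) :=
      (by fun_prop : Continuous fun x : ℝ => Real.exp (-|y - x|)).measurable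
    exact (c3.mul c1).sub (((measurable_side y).mul c3).mul c2)
  have hbound : Integrable fun η : ℝ => 335872 * L * N * Real.exp |y| * Real.exp (-(|η| / 4)) := by
    refine Integrable.const_mul ?_ _
    have := integrable_exp_neg_abs.comp_mul_left' (R := 1 / 4) (by norm_num)
    refine this.congr (Eventually.of_forall fun η => ?_)
    simp only [abs_mul]; norm_num; ring
  have key := (hasDerivAt_integral_of_dominated_loc_of_lip (μ := volume) (s := univ) (x₀ := t)
    (F := fun s η => Real.exp (-|y - pos (Q s) η|) * (dens φ₀ (Q s) η * Q s η))
    (F' := fun η => G (pos (Q t) η) * Q t η) univ_mem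
    (Eventually.of_forall fun s => (Adm.integrable_kernel hφ hN (hQ.adm s) y).aestronglyMeasurable)
    (Adm.integrable_kernel hφ hN (hQ.adm t) y)
    ((hmeas.comp hAt.continuous_pos.measurable).mul hAt.cont.measurable).aestronglyMeasurable
    (Eventually.of_forall fun η => ?_) hbound ?_).2.const_mul (1 / 2)
  · rw [hval] at key
    refine key.congr_of_eventuallyEq (Eventually.of_forall fun s => ?_)
    exact (hQ.adm s).green_vort φ₀ y
  · refine LipschitzOnWith.of_dist_le_mul fun a _ b _ => ?_
    rw [Real.dist_eq, Real.dist_eq, Real.coe_nnabs, abs_of_nonneg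
      (by positivity : 0 ≤ 335872 * L * N * Real.exp |y| * Real.exp (-(|η| / 4)))]
    have hr : ∀ s, |η| / 4 - |y| ≤ |y - pos (Q s) η| := fun s => by
      have h1 := (hQ.adm s).le_abs_pos η
      have h2 := abs_sub_abs_le_abs_sub (pos (Q s) η) y
      rw [abs_sub_comm] at h2
      linarith
    refine (abs_exp_mul_sub_le (hr a) (hr b)).trans ?_
    have hD : ∀ η, |Q a η - Q b η| ≤ L * |a - b| := hQ.lip a b
    have hD0 : 0 ≤ L * |a - b| := by positivity
    have e1 : |(|y - pos (Q a) η| - |y - pos (Q b) η|)| ≤ L * |a - b| * |η| := by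
      refine (abs_abs_sub_abs_le_abs_sub _ _).trans ?_
      rw [sub_sub_sub_cancel_left, abs_sub_comm]
      exact Adm.abs_pos_sub_pos_le (hQ.adm a) (hQ.adm b) hD η
    have e2 := (hQ.adm a).abs_weight_le φ₀ η
    have e3 := Adm.abs_weight_sub_le (hQ.adm a) (hQ.adm b) hD φ₀ η
    have e4 : Real.exp (-(|η| / 4 - |y|)) = Real.exp |y| * Real.exp (-(|η| / 4)) := by
      rw [← Real.exp_add]; ring_nf
    rw [e4]
    calc _ ≤ Real.exp |y| * Real.exp (-(|η| / 4)) * (L * |a - b| * |η| * (16384 * |φ₀ η|)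
            + 335872 * (L * |a - b|) * |φ₀ η|) := by gcongr
      _ = 335872 * (L * |a - b|) * (Real.exp |y| * Real.exp (-(|η| / 4)))
            * ((1 + 16384 / 335872 * |η|) * |φ₀ η|) := by ring
      _ ≤ 335872 * (L * |a - b|) * (Real.exp |y| * Real.exp (-(|η| / 4))) * N := by
          gcongr
          refine le_trans ?_ (hN η)
          gcongr
          exact mul_le_of_le_one_left (abs_nonneg _) (by norm_num)
      _ = _ := by ring
  · filter_upwards [(countable_singleton (0 : ℝ)).ae_notMem volume,
      (countable_singleton (lab (Q t) y)).ae_notMem volume] with η h0 hy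
    have hη : η ≠ 0 := h0
    have hPy : y - pos (Q t) η ≠ 0 := fun h => hy (by
      rw [sub_eq_zero.1 h, hAt.lab_pos]; rfl)
    have hw := hQ.hasDerivAt_weight hφ hN ht hη
    have hP := hQ.hasDerivAt_pos hφ hN ht η
    have habs : HasDerivAt (fun s => |y - pos (Q s) η|)
        ((if pos (Q t) η ≤ y then (-1 : ℝ) else 1)
          * (pos (Q t) η * green (vort φ₀ (Q t)) (pos (Q t) η))) t := by
      have h1 := (hasDerivAt_abs hPy).comp t (hP.const_sub y)
      refine h1.congr_deriv ?_
      split_ifs with hle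
      · rw [sign_pos (lt_of_le_of_ne (sub_nonneg.2 hle) hPy.symm)]; simp
      · rw [sign_neg (sub_neg.2 (not_le.1 hle))]; simp
    refine (habs.neg.exp.mul hw).congr_deriv ?_
    simp only [hG, source, flux, hAt.vort_pos, Pi.neg_apply]
    ring

/-- The path of stretchings yields a solution of the Cauchy problem. -/
theorem isSolution {g₀ : ℝ → ℝ} (hg₀ : ContDiff ℝ 2 g₀) {C : ℝ} (hC : ∀ y, |g₀ y| ≤ C)
    (hφ₀ : ∀ y, g₀ y - deriv (deriv g₀) y = φ₀ y) :
    IsSolution T g₀ (fun t => green (vort φ₀ (Q t))) := by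
  have hv : Continuous (Function.uncurry fun t => vort φ₀ (Q t)) :=
    continuous_uncurry_vort hQ.cont hQ.adm hφ
  have hvb : ∀ t x, |vort φ₀ (Q t) x| ≤ 16384 * N := fun t => (hQ.adm t).abs_vort_le hN
  have hvc : ∀ t, Continuous (vort φ₀ (Q t)) := fun t => (hQ.adm t).continuous_vort hφ
  have hg := continuous_green_uncurry hv hvb
  have hg' := continuous_greenD_uncurry hv hvb
  have hflux : Continuous (Function.uncurry fun t => flux φ₀ (Q t)) :=
    (continuous_snd.mul hg).mul hv
  have hsource : Continuous (Function.uncurry fun t => source φ₀ (Q t)) :=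
    (((continuous_const.mul continuous_snd).mul hg').sub (continuous_const.mul hg)).mul hv
  have hIco : ∀ t ∈ Ico 0 T, t ∈ Ioo (-T) T := fun t ht =>
    ⟨by linarith [ht.1, ht.2], ht.2⟩
  have htd : ∀ t ∈ Ico 0 T, ∀ y, timeDeriv T (fun t => green (vort φ₀ (Q t))) t y
      = green (source φ₀ (Q t)) y - greenD (flux φ₀ (Q t)) y := fun t ht y =>
    (hQ.hasDerivAt_green_vort hφ hN (hIco t ht) y).hasDerivWithinAt.derivWithin
      (uniqueDiffOn_Ico 0 T t ht)
  have hd : ∀ t, deriv (green (vort φ₀ (Q t))) = greenD (vort φ₀ (Q t)) := fun t =>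
    deriv_green (hvc t) (hvb t)
  have hdd : ∀ t, deriv (greenD (vort φ₀ (Q t)))
      = fun y => green (vort φ₀ (Q t)) y - vort φ₀ (Q t) y := fun t => deriv_greenD (hvc t) (hvb t)
  refine ⟨fun t _ => contDiff_green (hvc t) (hvb t), hg.continuousOn, ?_, ?_, fun y t ht => ?_, ?_,
    fun T' _ => ⟨16384 * N, fun t _ => abs_green_le (hvb t)⟩, fun t ht => ?_, fun y => ?_⟩
  · simp only [hd]; exact hg'.continuousOn
  · simp only [hd, hdd]; exact (hg.sub hv).continuousOn
  · exact (hQ.hasDerivAt_green_vort hφ hN (hIco t ht) y).differentiableAt.differentiableWithinAt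
  · refine ContinuousOn.congr (((continuous_green_uncurry hsource
      (fun t => (hQ.adm t).abs_source_le hN)).sub (continuous_greenD_uncurry hflux
      (fun t => (hQ.adm t).abs_flux_le hN))).continuousOn) fun p hp => ?_
    exact htd p.1 hp.1 p.2
  · have hs := (hQ.adm t).continuous_source hφ hN
    have hsb := (hQ.adm t).abs_source_le hN
    have hf := (hQ.adm t).continuous_flux hφ hN
    have hfb := (hQ.adm t).abs_flux_le hN
    have ht' : timeDeriv T (fun t => green (vort φ₀ (Q t))) t
        = fun y => green (source φ₀ (Q t)) y - greenD (flux φ₀ (Q t)) y := funext (htd t ht)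
    have hgs := continuous_green hs hsb
    have hgf := continuous_greenD hf hfb
    refine (equationAt_iff (contDiff_green (hvc t) (hvb t)) ?_).2 fun ψ hψ hψs => ?_
    · rw [ht']; exact hgs.sub hgf
    · have hψ2 : ContDiff ℝ 2 ψ := contDiff_infty.1 hψ 2
      have hψ' : ContDiff ℝ (⊤ : ℕ∞) (deriv ψ) := (contDiff_infty_iff_deriv.1 hψ).2
      have hψ'2 : ContDiff ℝ 2 (deriv ψ) := contDiff_infty.1 hψ' 2
      have hψ'' : ContDiff ℝ 2 (deriv (deriv ψ)) :=
        contDiff_infty.1 (contDiff_infty_iff_deriv.1 hψ').2 2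
      have c0 := hψ2.continuous
      have c1 := hψ'2.continuous
      have c2 := hψ''.continuous
      have c3 := hψ'2.continuous_deriv_deriv
      rw [ht']
      have i1 : Integrable fun y => green (source φ₀ (Q t)) y * (ψ y - deriv (deriv ψ) y) :=
        Continuous.integrable_of_hasCompactSupport (by fun_prop)
          (HasCompactSupport.sub hψs hψs.deriv.deriv).mul_left
      have i2 : Integrable fun y => greenD (flux φ₀ (Q t)) y * (ψ y - deriv (deriv ψ) y) :=
        Continuous.integrable_of_hasCompactSupport (by fun_prop)
          (HasCompactSupport.sub hψs hψs.deriv.deriv).mul_left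
      have j1 : Integrable fun y => source φ₀ (Q t) y * ψ y :=
        Continuous.integrable_of_hasCompactSupport (by fun_prop) hψs.mul_left
      have j2 : Integrable fun y => flux φ₀ (Q t) y * deriv ψ y :=
        Continuous.integrable_of_hasCompactSupport (by fun_prop) hψs.deriv.mul_left
      -- `1 - ∂²` is moved onto the Green functions; the flux term needs one derivative more.
      have e1 : ∫ y, green (source φ₀ (Q t)) y * (ψ y - deriv (deriv ψ) y)
          = ∫ y, source φ₀ (Q t) y * ψ y := by
        rw [integral_mul_sub_deriv_deriv (contDiff_green hs hsb) hψ2 hψs, deriv_green hs hsb,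
          deriv_greenD hs hsb]
        simp
      have e2 : ∫ y, greenD (flux φ₀ (Q t)) y * (ψ y - deriv (deriv ψ) y)
          = -∫ y, flux φ₀ (Q t) y * deriv ψ y := by
        have h1 := integral_mul_deriv_of_hasCompactSupport (hasDerivAt_green hf hfb)
          (b := fun y => ψ y - deriv (deriv ψ) y)
          (b' := fun y => deriv ψ y - deriv (deriv (deriv ψ)) y)
          (fun y => (hψ2.differentiable (by norm_num) y).hasDerivAt.sub
            (hψ''.differentiable (by norm_num) y).hasDerivAt) hgf (c1.sub c3)
            (HasCompactSupport.sub hψs hψs.deriv.deriv)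
        have h2 := integral_mul_sub_deriv_deriv (contDiff_green hf hfb) hψ'2 hψs.deriv
        rw [h2, deriv_green hf hfb, deriv_greenD hf hfb] at h1
        simp only [sub_sub_cancel] at h1
        rw [h1, neg_neg]
      calc ∫ y, (green (source φ₀ (Q t)) y - greenD (flux φ₀ (Q t)) y)
            * (ψ y - deriv (deriv ψ) y)
          = (∫ y, source φ₀ (Q t) y * ψ y) + ∫ y, flux φ₀ (Q t) y * deriv ψ y := by
            simp only [sub_mul (green _ _)]
            rw [integral_sub i1 i2, e1, e2, sub_neg_eq_add]
        _ = _ := by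
            rw [← integral_add j1 j2, hd, hdd]
            refine integral_congr_ae (Eventually.of_forall fun y => ?_)
            simp only [source, flux]
            ring
  · have hQ0 : Q 0 = fun _ => 1 := funext hQ.init
    have hv0 : vort φ₀ (Q 0) = φ₀ := by
      ext y
      have h1 := (hQ.adm 0).pos_lab y
      rw [pos_eq_mul_avg] at h1
      rw [hQ0, avg_const_one, mul_one] at h1
      rw [vort, dens, hQ0, h1, avg_const_one]
      simp
    have h1 := eq_green hg₀ hC (f := φ₀) (C' := 16384 * N) (fun y => by
      rw [← hv0]; exact hvb 0 y) hφ₀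
    simp only [hv0]
    exact (congrFun h1 y).symm

end IsPath

/-! ### Solutions on a closed time interval and their characteristics -/

/-- A solution of the equation on the closed time interval `[0, T]`, with `V = g` and `W = g_t`,
extended to all times by freezing it outside `[0, T]`. -/
structure WeakSol (T C : ℝ) (V W : ℝ → ℝ → ℝ) : Prop where
  contDiff : ∀ t, ContDiff ℝ 2 (V t)
  cont : Continuous fun p : ℝ × ℝ => V p.1 p.2
  cont_deriv : Continuous fun p : ℝ × ℝ => deriv (V p.1) p.2
  cont_deriv_deriv : Continuous fun p : ℝ × ℝ => deriv (deriv (V p.1)) p.2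
  cont_time : Continuous fun p : ℝ × ℝ => W p.1 p.2
  bound : ∀ t y, |V t y| ≤ C
  hasDerivAt_time : ∀ t ∈ Ioo 0 T, ∀ y, HasDerivAt (fun s => V s y) (W t y) t
  weak : ∀ t ∈ Icc 0 T, ∀ ψ : ℝ → ℝ, ContDiff ℝ (⊤ : ℕ∞) ψ → HasCompactSupport ψ →
    ∫ y, W t y * (ψ y - deriv (deriv ψ) y) = ∫ y, (V t y - deriv (deriv (V t)) y) *
      (y * V t y * deriv ψ y + (2 * y * deriv (V t) y - 3 * V t y) * ψ y)

theorem IsSolution.exists_weakSol {T : ℝ} {g₀ : ℝ → ℝ} {h : ℝ → ℝ → ℝ} (hh : IsSolution T g₀ h)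
    {T' : ℝ} (h0 : 0 ≤ T') (hT : T' < T) :
    ∃ C W, WeakSol T' C (fun t => h (max 0 (min t T'))) W := by
  obtain ⟨C, hC⟩ := hh.bounded T' hT
  have hcl : ∀ t : ℝ, max 0 (min t T') ∈ Icc 0 T' := fun t =>
    ⟨le_max_left _ _, max_le h0 (min_le_right _ _)⟩
  have hcl' : ∀ t : ℝ, max 0 (min t T') ∈ Ico 0 T := fun t =>
    ⟨(hcl t).1, (hcl t).2.trans_lt hT⟩
  have hcc : Continuous fun p : ℝ × ℝ => (max 0 (min p.1 T'), p.2) := by fun_prop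
  have hid : ∀ t ∈ Icc 0 T', max 0 (min t T') = t := fun t ht => by
    rw [min_eq_left ht.2, max_eq_right ht.1]
  have hm : ∀ p : ℝ × ℝ, (max 0 (min p.1 T'), p.2) ∈ Ico 0 T ×ˢ (univ : Set ℝ) := fun p =>
    ⟨hcl' p.1, mem_univ _⟩
  refine ⟨C, fun t => timeDeriv T h (max 0 (min t T')), fun t => hh.contDiff_space _ (hcl' t),
    hh.continuousOn.comp_continuous hcc hm, hh.continuousOn_deriv.comp_continuous hcc hm,
    hh.continuousOn_deriv_deriv.comp_continuous hcc hm,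
    hh.continuousOn_timeDeriv.comp_continuous hcc hm, fun t y => hC _ (hcl t) y,
    fun t ht y => ?_, fun t ht => ?_⟩
  · have ht' : t ∈ Icc 0 T' := Ioo_subset_Icc_self ht
    have h1 := ((hh.differentiableOn_time y) t ⟨ht'.1, ht'.2.trans_lt hT⟩).hasDerivWithinAt
    have h2 := h1.hasDerivAt (Ico_mem_nhds ht.1 (ht.2.trans hT))
    rw [hid t ht']
    refine h2.congr_of_eventuallyEq ?_
    filter_upwards [Ioo_mem_nhds ht.1 ht.2] with s hs
    rw [hid s (Ioo_subset_Icc_self hs)]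
  · have htT : t ∈ Ico 0 T := ⟨ht.1, ht.2.trans_lt hT⟩
    rw [hid t ht]
    refine (equationAt_iff (hh.contDiff_space t htT) ?_).1 (hh.equation t htT)
    exact hh.continuousOn_timeDeriv.comp_continuous (f := fun y : ℝ => (t, y)) (by fun_prop)
      fun y => ⟨htT, mem_univ _⟩

/-- Solution of a linear scalar equation `v' = k v` on `[0, T]`. -/
theorem eq_mul_exp_integral {T : ℝ} {v k : ℝ → ℝ} (hk : Continuous k)
    (hv : ∀ t ∈ Icc 0 T, HasDerivWithinAt v (k t * v t) (Icc 0 T) t) {t : ℝ} (ht : t ∈ Icc 0 T) :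
    v t = v 0 * Real.exp (∫ s in (0 : ℝ)..t, k s) := by
  have hK : ∀ t, HasDerivAt (fun t => ∫ s in (0 : ℝ)..t, k s) (k t) t := fun t =>
    (hk.integral_hasStrictDerivAt 0 t).hasDerivAt
  set w : ℝ → ℝ := fun t => v t * Real.exp (-∫ s in (0 : ℝ)..t, k s) with hw
  have hd : ∀ t ∈ Icc 0 T, HasDerivWithinAt w 0 (Icc 0 T) t := fun t ht =>
    ((hv t ht).mul (hK t).neg.exp.hasDerivWithinAt).congr_deriv (by simp only [Pi.neg_apply]; ring)
  have hc := constant_of_has_deriv_right_zero (fun t ht => (hd t ht).continuousWithinAt)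
    (fun t ht => (hd t (Ico_subset_Icc_self ht)).mono_of_mem_nhdsWithin
      (Icc_mem_nhdsGE_of_mem ht)) t ht
  simp only [hw, intervalIntegral.integral_same, neg_zero, Real.exp_zero, mul_one] at hc
  rw [← hc, mul_assoc, ← Real.exp_add]; simp

namespace WeakSol

variable {T C : ℝ} {V W : ℝ → ℝ → ℝ} (hV : WeakSol T C V W)
include hV

theorem C_nonneg : 0 ≤ C := (abs_nonneg _).trans (hV.bound 0 0)

theorem hasDerivAt_space (t y : ℝ) : HasDerivAt (V t) (deriv (V t) y) y :=
  ((hV.contDiff t).differentiable (by norm_num) y).hasDerivAt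

theorem hasDerivAt_velocity (t y : ℝ) :
    HasDerivAt (fun y => y * V t y) (V t y + y * deriv (V t) y) y :=
  ((hasDerivAt_id' y).mul (hV.hasDerivAt_space t y)).congr_deriv (by ring)

theorem cont_velocity_deriv :
    Continuous fun p : ℝ × ℝ => V p.1 p.2 + p.2 * deriv (V p.1) p.2 :=
  hV.cont.add (continuous_snd.mul hV.cont_deriv)

/-- The characteristic of `u = y g` through `η`. The vector field is truncated outside an interval
that the characteristic cannot leave before the time `T`. -/
theorem exists_characteristic (hT : 0 ≤ T) (η : ℝ) :
    ∃ Y : ℝ → ℝ, Continuous Y ∧ Y 0 = η ∧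
      ∀ t ∈ Icc 0 T, HasDerivWithinAt Y (Y t * V t (Y t)) (Icc 0 T) t := by
  have hC := hV.C_nonneg
  set R : ℝ := |η| * Real.exp (C * T) with hR
  have hR0 : 0 ≤ R := by positivity
  set c : ℝ → ℝ := fun x => max (-R) (min x R) with hc
  have hcmem : ∀ x, c x ∈ Icc (-R) R := fun x =>
    ⟨le_max_left _ _, max_le (by linarith) (min_le_right _ _)⟩
  have hcid : ∀ x, |x| ≤ R → c x = x := fun x hx => by
    rw [abs_le] at hx
    simp only [hc]; rw [min_eq_left hx.2, max_eq_right hx.1]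
  have hcle : ∀ x, |c x| ≤ |x| := fun x => by
    rcases le_or_gt |x| R with hx | hx
    · rw [hcid x hx]
    · exact (abs_le.2 (hcmem x)).trans hx.le
  have hclip : LipschitzWith 1 c := (LipschitzWith.id.min_const R).const_max (-R)
  have hcc : Continuous c := hclip.continuous
  obtain ⟨K, hK⟩ := (isCompact_Icc.prod isCompact_Icc).exists_bound_of_continuousOn
    (s := Icc (0 : ℝ) T ×ˢ Icc (-R) R) hV.cont_velocity_deriv.continuousOn
  have hK0 : 0 ≤ K := (norm_nonneg _).trans (hK (0, 0) ⟨⟨le_rfl, hT⟩, by linarith, hR0⟩)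
  have h0T : (0 : ℝ) ∈ Icc 0 T := ⟨le_rfl, hT⟩
  lift K to NNReal using hK0
  obtain ⟨L, hL⟩ : ∃ L : NNReal, (L : ℝ) = R * C := ⟨⟨R * C, by positivity⟩, rfl⟩
  obtain ⟨a, ha⟩ : ∃ a : NNReal, (a : ℝ) = R * C * T := ⟨⟨R * C * T, by positivity⟩, rfl⟩
  have hpl : IsPicardLindelof (fun t x => c x * V t (c x)) (⟨0, h0T⟩ : Icc (0 : ℝ) T) η
      a 0 L K := by
    refine ⟨fun t ht => ?_, fun x _ => ?_, fun t ht x _ => ?_, ?_⟩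
    · have h1 : LipschitzOnWith K (fun y => y * V t y) (Icc (-R) R) :=
        (convex_Icc _ _).lipschitzOnWith_of_nnnorm_hasDerivWithin_le
          (fun y _ => (hV.hasDerivAt_velocity t y).hasDerivWithinAt) fun y hy => hK (t, y) ⟨ht, hy⟩
      have h2 := h1.comp (hclip.lipschitzOnWith (s := Metric.closedBall η a))
        fun x _ => hcmem x
      rwa [mul_one] at h2
    · exact (continuous_const.mul (hV.cont.comp (continuous_id.prodMk continuous_const))).continuousOn
    · rw [Real.norm_eq_abs, abs_mul]
      rw [hL]
      exact mul_le_mul (abs_le.2 (hcmem x)) (hV.bound _ _) (abs_nonneg _) hR0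
    · simp [max_eq_left hT, hL, ha]
  obtain ⟨α, hα⟩ := ODE.FunSpace.exists_isFixedPt_next hpl
    (Metric.mem_closedBall_self (ε := ((0 : NNReal) : ℝ)) le_rfl)
  have hder : ∀ t ∈ Icc 0 T, HasDerivWithinAt α.compProj
      (c (α.compProj t) * V t (c (α.compProj t))) (Icc 0 T) t := by
    intro t ht
    have h1 := ODE.hasDerivWithinAt_picard_Icc h0T hpl.continuousOn_uncurry
      α.continuous_compProj.continuousOn
      (fun _ _ => α.compProj_mem_closedBall hpl.mul_max_le) η ht
    refine h1.congr_of_mem (fun s hs => ?_) ht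
    nth_rw 1 [← hα]
    rw [ODE.FunSpace.compProj_of_mem hs, ODE.FunSpace.next_apply]
  have h0 : α.compProj 0 = η := by
    rw [ODE.FunSpace.compProj_of_mem h0T, ← hα, ODE.FunSpace.next_apply₀]
  have hle : ∀ t ∈ Icc 0 T, |α.compProj t| ≤ R := fun t ht => by
    have h1 := norm_le_gronwallBound_of_norm_deriv_right_le (f := α.compProj) (δ := |η|) (K := C)
      (ε := 0) (a := 0) (b := T)
      α.continuous_compProj.continuousOn
      (fun t ht => (hder t (Ico_subset_Icc_self ht)).mono_of_mem_nhdsWithin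
        (Icc_mem_nhdsGE_of_mem ht)) (by rw [h0]; rfl) (fun t _ => by
        rw [Real.norm_eq_abs, abs_mul, add_zero, mul_comm, Real.norm_eq_abs]
        exact mul_le_mul (hV.bound _ _) (hcle _) (abs_nonneg _) hC) t ht
    rw [gronwallBound_ε0, sub_zero] at h1
    refine h1.trans ?_
    rw [hR]
    gcongr
    exact ht.2
  refine ⟨α.compProj, α.continuous_compProj, h0, fun t ht => ?_⟩
  have := hder t ht
  rwa [hcid _ (hle t ht)] at this

end WeakSol

/-- A flow of the velocity field `u = y V` on the time interval `[0, T]`, frozen outside it. -/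
structure IsFlow (T : ℝ) (V Y : ℝ → ℝ → ℝ) : Prop where
  cont_time : ∀ η, Continuous fun t => Y t η
  init : ∀ η, Y 0 η = η
  hasDerivWithinAt : ∀ η, ∀ t ∈ Icc 0 T,
    HasDerivWithinAt (fun t => Y t η) (Y t η * V t (Y t η)) (Icc 0 T) t
  frozen : ∀ t η, Y t η = Y (max 0 (min t T)) η

theorem WeakSol.exists_isFlow {T C : ℝ} {V W : ℝ → ℝ → ℝ} (hV : WeakSol T C V W) (hT : 0 ≤ T) :
    ∃ Y, IsFlow T V Y := by
  choose Y hY using hV.exists_characteristic hT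
  have hid : ∀ t ∈ Icc 0 T, max 0 (min t T) = t := fun t ht => by
    rw [min_eq_left ht.2, max_eq_right ht.1]
  have hcl : ∀ t : ℝ, max 0 (min t T) ∈ Icc 0 T := fun t =>
    ⟨le_max_left _ _, max_le hT (min_le_right _ _)⟩
  refine ⟨fun t η => Y η (max 0 (min t T)), ⟨fun η => (hY η).1.comp (by fun_prop), fun η => ?_,
    fun η t ht => ?_, fun t η => ?_⟩⟩
  · rw [hid 0 ⟨le_rfl, hT⟩]; exact (hY η).2.1
  · have := (hY η).2.2 t ht
    simp only [hid t ht]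
    exact this.congr_of_mem (fun s hs => by rw [hid s hs]) ht
  · simp only [hid _ (hcl t)]

/-! ### Dependence of the flow on the label -/

/-- The derivative `u_y` of the velocity `u = y V`. -/
noncomputable def velDeriv (V : ℝ → ℝ → ℝ) (t y : ℝ) : ℝ := V t y + y * deriv (V t) y

/-- The stretching `Y_η` of the flow `Y` of `u = y V`. -/
noncomputable def stretch (V Y : ℝ → ℝ → ℝ) (t η : ℝ) : ℝ :=
  Real.exp (∫ s in (0 : ℝ)..t, velDeriv V s (Y s η))

/-- The difference quotient of `u = y V` between `a` and `b`. -/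
noncomputable def velSlope (V : ℝ → ℝ → ℝ) (t a b : ℝ) : ℝ :=
  ∫ θ in (0 : ℝ)..1, velDeriv V t (b + θ * (a - b))

namespace WeakSol

variable {T C : ℝ} {V W : ℝ → ℝ → ℝ} (hV : WeakSol T C V W)
include hV

theorem continuous_velDeriv : Continuous fun p : ℝ × ℝ => velDeriv V p.1 p.2 :=
  hV.cont_velocity_deriv

theorem continuous_velSlope :
    Continuous fun p : ℝ × ℝ × ℝ => velSlope V p.1 p.2.1 p.2.2 :=
  intervalIntegral.continuous_parametric_intervalIntegral_of_continuous'
    (f := fun (p : ℝ × ℝ × ℝ) θ => velDeriv V p.1 (p.2.2 + θ * (p.2.1 - p.2.2)))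
    (hV.continuous_velDeriv.comp (by fun_prop : Continuous fun z : (ℝ × ℝ × ℝ) × ℝ =>
      (z.1.1, z.1.2.2 + z.2 * (z.1.2.1 - z.1.2.2)))) 0 1

theorem velSlope_mul (t a b : ℝ) : velSlope V t a b * (a - b) = a * V t a - b * V t b := by
  have hd : ∀ θ ∈ uIcc (0 : ℝ) 1, HasDerivAt
      (fun θ => (b + θ * (a - b)) * V t (b + θ * (a - b)))
      (velDeriv V t (b + θ * (a - b)) * (a - b)) θ := fun θ _ => by
    have h1 : HasDerivAt (fun θ => b + θ * (a - b)) (a - b) θ := by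
      simpa using ((hasDerivAt_id' θ).mul_const (a - b)).const_add b
    exact (hV.hasDerivAt_velocity t (b + θ * (a - b))).comp θ h1
  have hc : Continuous fun θ => velDeriv V t (b + θ * (a - b)) * (a - b) :=
    (hV.continuous_velDeriv.comp (by fun_prop : Continuous fun θ : ℝ =>
      (t, b + θ * (a - b)))).mul continuous_const
  rw [velSlope, ← intervalIntegral.integral_mul_const,
    intervalIntegral.integral_eq_sub_of_hasDerivAt hd (hc.intervalIntegrable _ _)]
  simp

end WeakSol

theorem velSlope_self (V : ℝ → ℝ → ℝ) (t a : ℝ) : velSlope V t a a = velDeriv V t a := by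
  simp [velSlope]

namespace IsFlow

variable {T C : ℝ} {V W Y : ℝ → ℝ → ℝ} (hV : WeakSol T C V W) (hY : IsFlow T V Y) (hT : 0 ≤ T)
include hV hY

theorem eq_mul_exp {t : ℝ} (ht : t ∈ Icc 0 T) (η : ℝ) :
    Y t η = η * Real.exp (∫ s in (0 : ℝ)..t, V s (Y s η)) := by
  have h := eq_mul_exp_integral (v := fun t => Y t η) (k := fun s => V s (Y s η))
    (hV.cont.comp (continuous_id.prodMk (hY.cont_time η)))
    (fun t ht => (hY.hasDerivWithinAt η t ht).congr_deriv (mul_comm _ _)) ht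
  simpa only [hY.init] using h

include hT in
theorem abs_le (t η : ℝ) : |Y t η| ≤ |η| * Real.exp (C * T) := by
  have hs : max 0 (min t T) ∈ Icc 0 T := ⟨le_max_left _ _, max_le hT (min_le_right _ _)⟩
  rw [hY.frozen, hY.eq_mul_exp hV hs, abs_mul, Real.abs_exp]
  have h1 := intervalIntegral.norm_integral_le_of_norm_le_const (a := 0) (b := max 0 (min t T))
    (C := C) (f := fun s => V s (Y s η)) (fun s _ => hV.bound _ _)
  rw [sub_zero, abs_of_nonneg hs.1] at h1
  have h2 : C * max 0 (min t T) ≤ C * T := mul_le_mul_of_nonneg_left hs.2 hV.C_nonneg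
  gcongr
  exact (le_abs_self _).trans (h1.trans h2)

/-- The distance of two characteristics solves a linear equation whose coefficient is the difference
quotient of `u`. -/
theorem sub_eq {t : ℝ} (ht : t ∈ Icc 0 T) (a b : ℝ) :
    Y t a - Y t b = (a - b) * Real.exp (∫ s in (0 : ℝ)..t, velSlope V s (Y s a) (Y s b)) := by
  have h := eq_mul_exp_integral (v := fun t => Y t a - Y t b)
    (k := fun s => velSlope V s (Y s a) (Y s b))
    (hV.continuous_velSlope.comp
      (continuous_id.prodMk ((hY.cont_time a).prodMk (hY.cont_time b))))
    (fun t ht => ((hY.hasDerivWithinAt a t ht).sub (hY.hasDerivWithinAt b t ht)).congr_deriv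
      (hV.velSlope_mul t _ _).symm) ht
  simpa only [hY.init] using h

include hT

theorem exists_lipschitz (R : ℝ) : ∃ K, ∀ t, ∀ a ∈ Icc (-R) R, ∀ b ∈ Icc (-R) R,
    |Y t a - Y t b| ≤ K * |a - b| := by
  set R' := R * Real.exp (C * T)
  obtain ⟨K, hK⟩ := (isCompact_Icc.prod (isCompact_Icc.prod isCompact_Icc)).exists_bound_of_continuousOn
    (s := Icc (0 : ℝ) T ×ˢ Icc (-R') R' ×ˢ Icc (-R') R') hV.continuous_velSlope.continuousOn
  refine ⟨Real.exp (K * T), fun t a ha b hb => ?_⟩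
  have hs : max 0 (min t T) ∈ Icc 0 T := ⟨le_max_left _ _, max_le hT (min_le_right _ _)⟩
  have hYR : ∀ s, ∀ c ∈ Icc (-R) R, Y s c ∈ Icc (-R') R' := fun s c hc =>
    _root_.abs_le.1 ((hY.abs_le hV hT s c).trans
      (mul_le_mul_of_nonneg_right (_root_.abs_le.2 hc) (Real.exp_pos _).le))
  have hK0 : 0 ≤ K := (norm_nonneg _).trans
    (hK (0, Y 0 a, Y 0 b) ⟨⟨le_rfl, hT⟩, hYR 0 a ha, hYR 0 b hb⟩)
  rw [hY.frozen, hY.frozen t b, hY.sub_eq hV hs, abs_mul, Real.abs_exp, mul_comm]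
  have h1 := intervalIntegral.norm_integral_le_of_norm_le_const (a := 0) (b := max 0 (min t T))
    (C := K) (f := fun s => velSlope V s (Y s a) (Y s b)) (fun s hs' => by
      rw [uIoc_of_le hs.1] at hs'
      exact hK (s, Y s a, Y s b) ⟨⟨hs'.1.le, hs'.2.trans hs.2⟩, hYR s a ha, hYR s b hb⟩)
  rw [sub_zero, abs_of_nonneg hs.1] at h1
  have h2 : K * max 0 (min t T) ≤ K * T := mul_le_mul_of_nonneg_left hs.2 hK0
  gcongr
  exact (le_abs_self _).trans (h1.trans h2)

theorem continuous : Continuous fun p : ℝ × ℝ => Y p.1 p.2 := by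
  refine continuous_iff_continuousAt.2 fun p₀ => ?_
  obtain ⟨K, hK⟩ := hY.exists_lipschitz hV hT (|p₀.2| + 1)
  have hc : Continuous fun p : ℝ × ℝ => K * |p.2 - p₀.2| + |Y p.1 p₀.2 - Y p₀.1 p₀.2| :=
    (continuous_const.mul (continuous_snd.sub continuous_const).abs).add
      (((hY.cont_time p₀.2).comp continuous_fst).sub continuous_const).abs
  have h0 := hc.tendsto p₀
  simp only [sub_self, abs_zero, mul_zero, add_zero] at h0
  have hnear : ∀ᶠ p : ℝ × ℝ in 𝓝 p₀, |p.2| ≤ |p₀.2| + 1 :=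
    (continuous_snd.abs.tendsto p₀).eventually_le_const (lt_add_one |p₀.2|)
  refine tendsto_iff_dist_tendsto_zero.2 (squeeze_zero' (Eventually.of_forall fun _ => dist_nonneg)
    (hnear.mono fun p hp => ?_) h0)
  rw [Real.dist_eq]
  calc |Y p.1 p.2 - Y p₀.1 p₀.2|
      ≤ |Y p.1 p.2 - Y p.1 p₀.2| + |Y p.1 p₀.2 - Y p₀.1 p₀.2| := abs_sub_le _ _ _
    _ ≤ _ := by
      gcongr
      exact hK p.1 p.2 (_root_.abs_le.1 hp) p₀.2 (_root_.abs_le.1 (le_add_of_nonneg_right zero_le_one))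

theorem continuous_velDeriv : Continuous fun p : ℝ × ℝ => velDeriv V p.1 (Y p.1 p.2) :=
  hV.continuous_velDeriv.comp (continuous_fst.prodMk (hY.continuous hV hT))

theorem continuous_stretch : Continuous fun p : ℝ × ℝ => stretch V Y p.1 p.2 :=
  (intervalIntegral.continuous_parametric_intervalIntegral_of_continuous
    (f := fun (p : ℝ × ℝ) s => velDeriv V s (Y s p.2))
    ((hY.continuous_velDeriv hV hT).comp (by fun_prop : Continuous fun z : (ℝ × ℝ) × ℝ =>
      (z.2, z.1.2))) continuous_fst).rexp

/-- The flow is differentiable in the label, because its increments solve a linear equation with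
a coefficient that is continuous in both labels. -/
theorem hasDerivAt_label {t : ℝ} (ht : t ∈ Icc 0 T) (η : ℝ) :
    HasDerivAt (Y t) (stretch V Y t η) η := by
  have hc : Continuous fun a => Real.exp (∫ s in (0 : ℝ)..t, velSlope V s (Y s a) (Y s η)) :=
    (intervalIntegral.continuous_parametric_intervalIntegral_of_continuous'
      (f := fun a s => velSlope V s (Y s a) (Y s η))
      (hV.continuous_velSlope.comp (continuous_snd.prodMk
        (((hY.continuous hV hT).comp (continuous_snd.prodMk continuous_fst)).prodMk
          ((hY.cont_time η).comp continuous_snd)))) 0 t).rexp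
  have h0 := hc.tendsto η
  simp only [velSlope_self] at h0
  rw [hasDerivAt_iff_tendsto_slope]
  refine (h0.mono_left nhdsWithin_le_nhds).congr' ?_
  filter_upwards [self_mem_nhdsWithin] with a ha
  have ha' : a - η ≠ 0 := sub_ne_zero.2 ha
  rw [slope_def_field, hY.sub_eq hV ht]
  field_simp

theorem hasDerivAt_stretch (t η : ℝ) : HasDerivAt (fun s => stretch V Y s η)
    (stretch V Y t η * velDeriv V t (Y t η)) t :=
  (((hY.continuous_velDeriv hV hT).comp
    (continuous_id.prodMk continuous_const)).integral_hasStrictDerivAt 0 t).hasDerivAt.exp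

theorem continuous_stretch_right (t : ℝ) : Continuous (stretch V Y t) :=
  (hY.continuous_stretch hV hT).comp (continuous_const.prodMk continuous_id)

theorem pos_stretch {t : ℝ} (ht : t ∈ Icc 0 T) (η : ℝ) : pos (stretch V Y t) η = Y t η := by
  rw [pos, intervalIntegral.integral_eq_sub_of_hasDerivAt
    (fun x _ => hY.hasDerivAt_label hV hT ht x)
    ((hY.continuous_stretch_right hV hT t).intervalIntegrable _ _), hY.eq_mul_exp hV ht 0]
  ring

/-- Both sides are `Y / η` for `η ≠ 0`; at the fixed point `0` both are `exp ∫ V(s, 0) ds`. -/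
theorem avg_stretch {t : ℝ} (ht : t ∈ Icc 0 T) (η : ℝ) :
    avg (stretch V Y t) η = Real.exp (∫ s in (0 : ℝ)..t, V s (Y s η)) := by
  rcases eq_or_ne η 0 with rfl | hη
  · simp only [avg, mul_zero, stretch, intervalIntegral.integral_const]
    have : ∀ s ∈ uIcc 0 t, velDeriv V s (Y s 0) = V s (Y s 0) := fun s hs => by
      rw [uIcc_of_le ht.1] at hs
      have h0 : Y s 0 = 0 := by rw [hY.eq_mul_exp hV ⟨hs.1, hs.2.trans ht.2⟩ 0, zero_mul]
      rw [velDeriv, h0]; ring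
    rw [intervalIntegral.integral_congr this]
    simp
  · have h1 := hY.pos_stretch hV hT ht η
    rw [pos_eq_mul_avg, hY.eq_mul_exp hV ht] at h1
    exact mul_left_cancel₀ hη h1

end IsFlow

/-! ### The function `φ` along characteristics -/

/-- The function `φ = V - V_{yy}` of a solution `V`. -/
noncomputable def solVort (V : ℝ → ℝ → ℝ) (t y : ℝ) : ℝ := V t y - deriv (deriv (V t)) y

theorem integral_eq_mul_integral_affine (F : ℝ → ℝ) (a : ℝ) {ε : ℝ} (hε : 0 < ε) :
    ∫ x, F x = ε * ∫ z, F (a + ε * z) := by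
  have h := Measure.integral_comp_mul_left (fun x => F (a + x)) ε
  rw [h, integral_add_left_eq_self F a, abs_of_pos (inv_pos.2 hε), smul_eq_mul, ← mul_assoc,
    mul_inv_cancel₀ hε.ne', one_mul]

theorem exists_bump : ∃ ρ : ℝ → ℝ, ContDiff ℝ (⊤ : ℕ∞) ρ ∧ HasCompactSupport ρ ∧
    tsupport ρ ⊆ Ioc (-2) 2 ∧ ∫ z, ρ z = 1 := by
  let b : ContDiffBump (0 : ℝ) := ⟨1 / 2, 1, by norm_num, by norm_num⟩
  refine ⟨b.normed volume, b.contDiff_normed, b.hasCompactSupport_normed, ?_, b.integral_normed⟩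
  rw [b.tsupport_normed_eq, Real.closedBall_eq_Icc]
  intro x hx
  have h1 : (0 : ℝ) - 1 ≤ x := hx.1
  have h2 : x ≤ 0 + 1 := hx.2
  constructor <;> linarith

theorem WeakSol.continuous_solVort {T C : ℝ} {V W : ℝ → ℝ → ℝ} (hV : WeakSol T C V W) :
    Continuous fun p : ℝ × ℝ => solVort V p.1 p.2 :=
  hV.cont.sub hV.cont_deriv_deriv

theorem WeakSol.continuous_solVort_right {T C : ℝ} {V W : ℝ → ℝ → ℝ} (hV : WeakSol T C V W)
    (t : ℝ) : Continuous (solVort V t) :=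
  hV.continuous_solVort.comp (continuous_const.prodMk continuous_id)

namespace IsFlow

variable {T C : ℝ} {V W Y : ℝ → ℝ → ℝ} (hV : WeakSol T C V W) (hY : IsFlow T V Y) (hT : 0 ≤ T)
include hV hY hT

/-- The weak equation tested against a profile `P` that moves with a characteristic. -/
theorem hasDerivAt_integral_solVort {P : ℝ → ℝ} (hP : ContDiff ℝ (⊤ : ℕ∞) P)
    (hs : HasCompactSupport P) {t : ℝ} (ht : t ∈ Ioo 0 T) (η : ℝ) :
    HasDerivAt (fun t => ∫ x, solVort V t x * P (x - Y t η))
      (∫ x, solVort V t x * ((x * V t x - Y t η * V t (Y t η)) * deriv P (x - Y t η)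
        + (2 * x * deriv (V t) x - 3 * V t x) * P (x - Y t η))) t := by
  have hP1 : ContDiff ℝ (⊤ : ℕ∞) (deriv P) := (contDiff_infty_iff_deriv.1 hP).2
  have hP2 : ContDiff ℝ (⊤ : ℕ∞) (deriv (deriv P)) := (contDiff_infty_iff_deriv.1 hP1).2
  have hP3 : ContDiff ℝ (⊤ : ℕ∞) (deriv (deriv (deriv P))) := (contDiff_infty_iff_deriv.1 hP2).2
  have c0 := hP.continuous
  have c1 := hP1.continuous
  have c2 := hP2.continuous
  have c3 := hP3.continuous
  set χ : ℝ → ℝ := fun x => P x - deriv (deriv P) x with hχ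
  set χ' : ℝ → ℝ := fun x => deriv P x - deriv (deriv (deriv P)) x with hχ'
  have hχd : ∀ x, HasDerivAt χ (χ' x) x := fun x =>
    (hP.differentiable (by simp) x).hasDerivAt.sub (hP2.differentiable (by simp) x).hasDerivAt
  have cχ : Continuous χ := c0.sub c2
  have cχ' : Continuous χ' := c1.sub c3
  have sχ : HasCompactSupport χ := HasCompactSupport.sub hs hs.deriv.deriv
  have hshift : ∀ {f : ℝ → ℝ} (a : ℝ), HasCompactSupport f → HasCompactSupport fun x => f (x - a) :=
    fun a hf => hf.comp_homeomorph (Homeomorph.subRight a)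
  have hds : ∀ (f : ℝ → ℝ) (a : ℝ), deriv (fun x => f (x - a)) = fun x => deriv f (x - a) :=
    fun f a => funext fun x => deriv_comp_sub_const f a x
  -- Both `χ` and `χ'` vanish outside `[-r, r]`.
  obtain ⟨r, hr⟩ := sχ.isCompact.isBounded.subset_closedBall 0
  have hr0 : ∀ x, r < |x| → χ x = 0 ∧ χ' x = 0 := fun x hx => by
    have hx' : x ∉ tsupport χ := fun h => by
      have := hr h
      rw [mem_closedBall_zero_iff, Real.norm_eq_abs] at this
      linarith
    refine ⟨image_eq_zero_of_notMem_tsupport hx', ?_⟩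
    rw [← (hχd x).deriv]
    by_contra h
    exact hx' (support_deriv_subset h)
  have e0 : ∀ t, ∫ x, solVort V t x * P (x - Y t η) = ∫ x, V t x * χ (x - Y t η) := fun t => by
    have h1 := integral_mul_sub_deriv_deriv (hV.contDiff t)
      (ψ := fun x => P (x - Y t η)) ((contDiff_infty.1 hP 2).comp (contDiff_id.sub contDiff_const))
      (hshift _ hs)
    rw [hds, hds] at h1
    exact h1.symm
  have hYd : ∀ s ∈ Ioo 0 T, HasDerivAt (fun s => Y s η) (Y s η * V s (Y s η)) s := fun s hs =>
    (hY.hasDerivWithinAt η s (Ioo_subset_Icc_self hs)).hasDerivAt (Icc_mem_nhds hs.1 hs.2)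
  set B := |η| * Real.exp (C * T)
  have hYB : ∀ s, |Y s η| ≤ B := fun s => hY.abs_le hV hT s η
  set F' : ℝ → ℝ → ℝ := fun s x =>
    W s x * χ (x - Y s η) + V s x * (χ' (x - Y s η) * -(Y s η * V s (Y s η))) with hF'
  have cY := hY.cont_time η
  have cF' : Continuous fun p : ℝ × ℝ => F' p.1 p.2 := by
    have h1 : Continuous fun p : ℝ × ℝ => p.2 - Y p.1 η :=
      continuous_snd.sub (cY.comp continuous_fst)
    have h2 : Continuous fun p : ℝ × ℝ => V p.1 (Y p.1 η) :=
      hV.cont.comp (continuous_fst.prodMk (cY.comp continuous_fst))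
    exact (hV.cont_time.mul (cχ.comp h1)).add (hV.cont.mul ((cχ'.comp h1).mul
      (((cY.comp continuous_fst).mul h2).neg)))
  obtain ⟨M, hM⟩ := (isCompact_Icc.prod isCompact_Icc).exists_bound_of_continuousOn
    (s := Icc (0 : ℝ) T ×ˢ Icc (-(r + B)) (r + B)) cF'.continuousOn
  have cV : Continuous (V t) := hV.cont.comp (continuous_const.prodMk continuous_id)
  have cW : Continuous (W t) := hV.cont_time.comp (continuous_const.prodMk continuous_id)
  have key := (hasDerivAt_integral_of_dominated_loc_of_deriv_le (μ := volume) (s := Ioo 0 T)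
    (F := fun s x => V s x * χ (x - Y s η)) (F' := F')
    (bound := (Icc (-(r + B)) (r + B)).indicator fun _ => M) (x₀ := t)
    (Ioo_mem_nhds ht.1 ht.2) (Eventually.of_forall fun s => ?_) ?_ ?_
    (Eventually.of_forall fun x s hs => ?_) ?_ (Eventually.of_forall fun x s hs => ?_)).2
  · simp only [e0]
    refine key.congr_deriv ?_
    have w1 := hV.weak t (Ioo_subset_Icc_self ht) (fun x => P (x - Y t η))
      (hP.comp (contDiff_id.sub contDiff_const)) (hshift _ hs)
    have w2 := integral_mul_sub_deriv_deriv (hV.contDiff t)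
      (ψ := fun x => deriv P (x - Y t η))
      ((contDiff_infty.1 hP1 2).comp (contDiff_id.sub contDiff_const)) (hshift _ hs.deriv)
    rw [hds, hds] at w1 w2
    have cφ := hV.continuous_solVort_right t
    have cV' : Continuous (deriv (V t)) := (hV.contDiff t).continuous_deriv (by norm_num)
    have i1 : Integrable fun x => W t x * χ (x - Y t η) :=
      Continuous.integrable_of_hasCompactSupport (by fun_prop) (hshift _ sχ).mul_left
    have sχ' : HasCompactSupport χ' := HasCompactSupport.sub hs.deriv hs.deriv.deriv.deriv
    have i2 : Integrable fun x => V t x * χ' (x - Y t η) :=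
      Continuous.integrable_of_hasCompactSupport (by fun_prop) (hshift _ sχ').mul_left
    have i3 : Integrable fun x => solVort V t x *
        (x * V t x * deriv P (x - Y t η) + (2 * x * deriv (V t) x - 3 * V t x) * P (x - Y t η)) :=
      Continuous.integrable_of_hasCompactSupport (by fun_prop)
        (HasCompactSupport.add (hshift _ hs.deriv).mul_left (hshift _ hs).mul_left).mul_left
    have i4 : Integrable fun x => solVort V t x * deriv P (x - Y t η) :=
      Continuous.integrable_of_hasCompactSupport (by fun_prop) (hshift _ hs.deriv).mul_left
    calc ∫ x, F' t x
        = (∫ x, W t x * χ (x - Y t η))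
          + -(Y t η * V t (Y t η)) * ∫ x, V t x * χ' (x - Y t η) := by
          rw [← integral_const_mul, ← integral_add i1 (i2.const_mul _)]
          refine integral_congr_ae (Eventually.of_forall fun x => ?_)
          simp only [hF']; ring
      _ = (∫ x, solVort V t x *
          (x * V t x * deriv P (x - Y t η) + (2 * x * deriv (V t) x - 3 * V t x) * P (x - Y t η)))
          + -(Y t η * V t (Y t η)) * ∫ x, solVort V t x * deriv P (x - Y t η) := by
          simp only [hχ, hχ']
          rw [w1, w2]; rfl
      _ = _ := by
          rw [← integral_const_mul, ← integral_add i3 (i4.const_mul _)]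
          refine integral_congr_ae (Eventually.of_forall fun x => ?_)
          simp only; ring
  · exact ((hV.cont.comp (continuous_const.prodMk continuous_id)).mul
      (cχ.comp (continuous_id.sub continuous_const))).aestronglyMeasurable
  · exact Continuous.integrable_of_hasCompactSupport
      (cV.mul (cχ.comp (continuous_id.sub continuous_const))) (hshift _ sχ).mul_left
  · exact (cF'.comp (continuous_const.prodMk continuous_id)).aestronglyMeasurable
  · by_cases hx : x ∈ Icc (-(r + B)) (r + B)
    · rw [indicator_of_mem hx]
      exact hM (s, x) ⟨Ioo_subset_Icc_self hs, hx⟩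
    · rw [indicator_of_notMem hx]
      have h1 : r + B < |x| := by
        by_contra h
        exact hx (_root_.abs_le.1 (not_lt.1 h))
      have h2 : r < |x - Y s η| := by
        have := abs_sub_abs_le_abs_sub x (Y s η)
        have := hYB s
        linarith
      simp [hF', (hr0 _ h2).1, (hr0 _ h2).2]
  · exact (integrable_indicator_iff measurableSet_Icc).2
      (continuous_const.integrableOn_Icc)
  · exact (hV.hasDerivAt_time s hs x).mul ((hχd _).comp s ((hYd s hs).const_sub x))

/-- Along a characteristic `φ` solves `d/dt φ = (Y g_y - 4 g) φ`. The equation is tested with a bump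
of width `ε` carried by the characteristic; after rescaling, the identity is continuous up to
`ε = 0`. -/
theorem solVort_eq_add_integral {t : ℝ} (ht : t ∈ Icc 0 T) (η : ℝ) :
    solVort V t (Y t η) = solVort V 0 η + ∫ s in (0 : ℝ)..t,
      (Y s η * deriv (V s) (Y s η) - 4 * V s (Y s η)) * solVort V s (Y s η) := by
  obtain ⟨ρ, hρ, hρs, hρt, hρi⟩ := exists_bump
  have hρ1 : ContDiff ℝ (⊤ : ℕ∞) (deriv ρ) := (contDiff_infty_iff_deriv.1 hρ).2
  have cρ := hρ.continuous
  have cρ1 := hρ1.continuous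
  have cY := hY.cont_time η
  set c : ℝ → ℝ → ℝ := fun s x => 2 * x * deriv (V s) x - 3 * V s x with hc
  -- `J ε` is the mean of `φ` against the bump of width `ε`, and `K ε` its time derivative.
  set J : ℝ → ℝ → ℝ := fun ε s => ∫ z in (-2 : ℝ)..2, solVort V s (Y s η + ε * z) * ρ z with hJ
  set K : ℝ → ℝ → ℝ := fun ε s => ∫ z in (-2 : ℝ)..2, solVort V s (Y s η + ε * z) *
    (velSlope V s (Y s η + ε * z) (Y s η) * (z * deriv ρ z) + c s (Y s η + ε * z) * ρ z) with hK
  have ca : Continuous fun p : (ℝ × ℝ) × ℝ => Y p.1.2 η + p.1.1 * p.2 :=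
    (cY.comp (by fun_prop)).add (by fun_prop)
  have cs : Continuous fun p : (ℝ × ℝ) × ℝ => p.1.2 := by fun_prop
  have cφ : Continuous fun p : (ℝ × ℝ) × ℝ => solVort V p.1.2 (Y p.1.2 η + p.1.1 * p.2) :=
    hV.continuous_solVort.comp (cs.prodMk ca)
  have cJ : Continuous fun p : ℝ × ℝ => J p.1 p.2 :=
    intervalIntegral.continuous_parametric_intervalIntegral_of_continuous'
      (f := fun (p : ℝ × ℝ) z => solVort V p.2 (Y p.2 η + p.1 * z) * ρ z)
      (cφ.mul (cρ.comp continuous_snd)) (-2) 2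
  have cK : Continuous fun p : ℝ × ℝ => K p.1 p.2 := by
    refine intervalIntegral.continuous_parametric_intervalIntegral_of_continuous'
      (f := fun (p : ℝ × ℝ) z => solVort V p.2 (Y p.2 η + p.1 * z) *
        (velSlope V p.2 (Y p.2 η + p.1 * z) (Y p.2 η) * (z * deriv ρ z)
          + c p.2 (Y p.2 η + p.1 * z) * ρ z)) ?_ (-2) 2
    refine cφ.mul (((hV.continuous_velSlope.comp (cs.prodMk (ca.prodMk (cY.comp cs)))).mul
      (continuous_snd.mul (cρ1.comp continuous_snd))).add (Continuous.mul ?_ (cρ.comp continuous_snd)))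
    exact ((continuous_const.mul ca).mul (hV.cont_deriv.comp (cs.prodMk ca))).sub
      (continuous_const.mul (hV.cont.comp (cs.prodMk ca)))
  have hsupp : ∀ F : ℝ → ℝ, (∀ z, z ∉ tsupport ρ → F z = 0) →
      ∫ z in (-2 : ℝ)..2, F z = ∫ z, F z := fun F hF =>
    intervalIntegral.integral_eq_integral_of_support_subset fun z hz =>
      hρt (by by_contra h; exact hz (hF z h))
  have hρ0 : ∀ z, z ∉ tsupport ρ → ρ z = 0 := fun z hz => image_eq_zero_of_notMem_tsupport hz
  have hρ10 : ∀ z, z ∉ tsupport ρ → deriv ρ z = 0 := fun z hz => by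
    by_contra h; exact hz (support_deriv_subset h)
  have hd : ∀ ε > 0, ∀ s ∈ Ioo 0 T, HasDerivAt (J ε) (K ε s) s := fun ε hε s hs => by
    have hPd : ∀ x, deriv (fun x => ρ (x / ε)) x = deriv ρ (x / ε) / ε := fun x => by
      have := (hρ.differentiable (by simp) (x / ε)).hasDerivAt.comp x
        ((hasDerivAt_id' x).div_const ε)
      exact this.deriv.trans (by ring)
    have h1 := hY.hasDerivAt_integral_solVort hV hT (P := fun x => ρ (x / ε))
      (hρ.comp (contDiff_id.div_const ε)) (by
        have := hρs.comp_homeomorph (Homeomorph.mulRight₀ ε⁻¹ (inv_ne_zero hε.ne'))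
        simpa [Function.comp_def, div_eq_mul_inv] using this) hs η
    have h2 := h1.const_mul ε⁻¹
    have hz : ∀ s z : ℝ, (Y s η + ε * z - Y s η) / ε = z := fun s z => by field_simp; ring
    have e1 : (fun s => ε⁻¹ * ∫ x, solVort V s x * ρ ((x - Y s η) / ε)) = J ε := by
      ext s
      rw [integral_eq_mul_integral_affine _ (Y s η) hε, ← mul_assoc, inv_mul_cancel₀ hε.ne', one_mul,
        hJ]
      simp only
      rw [hsupp _ fun z hz => by rw [hρ0 z hz, mul_zero]]
      simp only [hz]
    rw [e1] at h2
    refine h2.congr_deriv ?_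
    rw [integral_eq_mul_integral_affine _ (Y s η) hε, ← mul_assoc, inv_mul_cancel₀ hε.ne', one_mul,
      hK]
    simp only
    rw [hsupp _ fun z hz => by rw [hρ0 z hz, hρ10 z hz]; ring]
    refine integral_congr_ae (Eventually.of_forall fun z => ?_)
    simp only [hPd, hz, hc]
    rw [← hV.velSlope_mul]
    field_simp
    ring
  have hFTC : ∀ ε > 0, J ε t - J ε 0 = ∫ s in (0 : ℝ)..t, K ε s := fun ε hε => by
    refine (intervalIntegral.integral_eq_sub_of_hasDerivAt_of_le ht.1
      (cJ.comp (continuous_const.prodMk continuous_id)).continuousOn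
      (fun s hs => hd ε hε s ⟨hs.1, hs.2.trans_le ht.2⟩)
      ((cK.comp (continuous_const.prodMk continuous_id)).intervalIntegrable _ _)).symm
  have hlim : J 0 t - J 0 0 = ∫ s in (0 : ℝ)..t, K 0 s := by
    have l1 : Tendsto (fun ε => J ε t - J ε 0) (𝓝[>] 0) (𝓝 (J 0 t - J 0 0)) :=
      (((cJ.comp (continuous_id.prodMk continuous_const)).sub
        (cJ.comp (continuous_id.prodMk continuous_const))).tendsto 0).mono_left nhdsWithin_le_nhds
    have l2 : Tendsto (fun ε => ∫ s in (0 : ℝ)..t, K ε s) (𝓝[>] 0)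
        (𝓝 (∫ s in (0 : ℝ)..t, K 0 s)) :=
      ((intervalIntegral.continuous_parametric_intervalIntegral_of_continuous' (f := K) cK
        0 t).tendsto 0).mono_left nhdsWithin_le_nhds
    refine tendsto_nhds_unique l1 (l2.congr' ?_)
    filter_upwards [self_mem_nhdsWithin] with ε hε
    exact (hFTC ε hε).symm
  have hint : ∫ z in (-2 : ℝ)..2, ρ z = 1 := by rw [hsupp ρ hρ0, hρi]
  have hint1 : ∫ z in (-2 : ℝ)..2, z * deriv ρ z = -1 := by
    rw [hsupp _ fun z hz => by rw [hρ10 z hz, mul_zero],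
      integral_mul_deriv_of_hasCompactSupport (a' := fun _ => 1) hasDerivAt_id'
        (fun z => (hρ.differentiable (by simp) z).hasDerivAt) continuous_const cρ1 hρs]
    simp [hρi]
  have hJ0 : ∀ s, J 0 s = solVort V s (Y s η) := fun s => by
    simp only [hJ, zero_mul, add_zero]
    rw [intervalIntegral.integral_const_mul, hint, mul_one]
  have hK0 : ∀ s, K 0 s = (Y s η * deriv (V s) (Y s η) - 4 * V s (Y s η)) * solVort V s (Y s η) :=
    fun s => by
    simp only [hK, zero_mul, add_zero, velSlope_self]
    rw [intervalIntegral.integral_const_mul, intervalIntegral.integral_add,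
      intervalIntegral.integral_const_mul, intervalIntegral.integral_const_mul, hint, hint1]
    · simp only [hc, velDeriv]; ring
    · exact Continuous.intervalIntegrable (by fun_prop) _ _
    · exact Continuous.intervalIntegrable (by fun_prop) _ _
  simp only [hJ0, hK0, hY.init] at hlim
  linarith

/-- The values of `φ` along the flow are determined by the stretching. -/
theorem solVort_eq_dens {t : ℝ} (ht : t ∈ Icc 0 T) (η : ℝ) :
    solVort V t (Y t η) = dens (solVort V 0) (stretch V Y t) η := by
  have cY := hY.cont_time η
  have c0 : Continuous fun s : ℝ => (s, Y s η) := continuous_id.prodMk cY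
  have ck : Continuous fun s => Y s η * deriv (V s) (Y s η) - 4 * V s (Y s η) :=
    (cY.mul (hV.cont_deriv.comp c0)).sub (continuous_const.mul (hV.cont.comp c0))
  have ci : Continuous fun s => (Y s η * deriv (V s) (Y s η) - 4 * V s (Y s η))
      * solVort V s (Y s η) := ck.mul (hV.continuous_solVort.comp c0)
  have h := eq_mul_exp_integral (v := fun s => solVort V s (Y s η)) ck (fun s hs =>
    (((ci.integral_hasStrictDerivAt 0 s).hasDerivAt.const_add
      (solVort V 0 η)).hasDerivWithinAt (s := Icc 0 T)).congr_of_mem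
      (fun s hs => hY.solVort_eq_add_integral hV hT hs η) hs) ht
  simp only [hY.init] at h
  rw [h, dens, hY.avg_stretch hV hT ht, stretch, mul_div_assoc, ← Real.exp_nat_mul, ← Real.exp_sub]
  congr 2
  have i1 : IntervalIntegrable (fun s => velDeriv V s (Y s η)) volume 0 t :=
    (hV.continuous_velDeriv.comp c0).intervalIntegrable _ _
  have i2 : IntervalIntegrable (fun s => ((5 : ℕ) : ℝ) * V s (Y s η)) volume 0 t :=
    (continuous_const.mul (hV.cont.comp c0)).intervalIntegrable _ _
  rw [← intervalIntegral.integral_const_mul, ← intervalIntegral.integral_sub i1 i2]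
  refine intervalIntegral.integral_congr fun s _ => ?_
  simp only [velDeriv]
  push_cast
  ring

end IsFlow

/-! ### Localized estimates and uniqueness -/

theorem abs_sub_le_of_abs_deriv_le {E e B b : ℝ → ℝ} {u v : ℝ} (huv : u ≤ v)
    (hE : ∀ x, HasDerivAt E (e x) x) (hB : ∀ x, HasDerivAt B (b x) x)
    (h : ∀ x ∈ Ico u v, |e x| ≤ b x) : |E v - E u| ≤ B v - B u :=
  image_norm_le_of_norm_deriv_right_le_deriv_boundary (f := fun x => E x - E u)
    (B := fun x => B x - B u)
    (fun x _ => ((hE x).sub_const _).continuousAt.continuousWithinAt)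
    (fun x _ => ((hE x).sub_const _).hasDerivWithinAt) (by simp)
    (fun x => (hB x).sub_const _) h ⟨huv, le_rfl⟩

/-- Interior bound for `w + w'` at `y ∈ [a, b]`: the contribution of the part beyond `b`, where
`w - w''` is not controlled, decays exponentially in the distance `b - y`. The mean value theorem
supplies a point near `b` with a bounded slope, from which the equation
`(e^{-x} (w + w'))' = -e^{-x} (w - w'')` is integrated. -/
theorem weighted_add_deriv_le {w w₁ w₂ : ℝ → ℝ} (h1 : ∀ x, HasDerivAt w (w₁ x) x)
    (h2 : ∀ x, HasDerivAt w₁ (w₂ x) x) {C N a b y : ℝ} (hC : ∀ x, |w x| ≤ C)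
    (hN : ∀ x ∈ Icc a b, (1 + |x|) * |w x - w₂ x| ≤ N) (hab : a + 1 ≤ b) (hy : y ∈ Icc a b) :
    (1 + |y|) * |w y + w₁ y| ≤ 24 * C * (1 + |y|) * Real.exp (-(b - y)) + 6 * N := by
  have hC0 : 0 ≤ C := (abs_nonneg _).trans (hC 0)
  have hN0 : 0 ≤ N := le_trans (by positivity) (hN y hy)
  obtain ⟨b', hb', hslope⟩ := exists_hasDerivAt_eq_slope w w₁ (sub_one_lt b)
    (fun x _ => (h1 x).continuousAt.continuousWithinAt) (fun x _ => h1 x)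
  have hpb : |w b' + w₁ b'| ≤ 3 * C := by
    have e : w₁ b' = w b - w (b - 1) := by rw [hslope]; ring
    have := abs_add_le (w b') (w₁ b')
    have h3 := abs_sub (w b) (w (b - 1))
    rw [← e] at h3
    linarith [hC b', hC b, hC (b - 1)]
  have he1 : Real.exp 1 ≤ 2.7182818286 := Real.exp_one_lt_d9.le
  have hE : ∀ x, HasDerivAt (fun x => Real.exp (-x) * (w x + w₁ x))
      (-(Real.exp (-x) * (w x - w₂ x))) x := fun x =>
    ((hasDerivAt_neg x).exp.mul ((h1 x).add (h2 x))).congr_deriv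
      (by simp only [Pi.add_apply]; ring)
  have hyp : 0 < 1 + |y| := by positivity
  have hNx : ∀ x ∈ Icc a b, |w x - w₂ x| ≤ (1 + |x - y|) * (N / (1 + |y|)) := fun x hx => by
    rw [mul_div_assoc', le_div_iff₀ hyp]
    have h3 := hN x hx
    have h4 : 1 + |y| ≤ (1 + |x - y|) * (1 + |x|) := by
      have := abs_sub_abs_le_abs_sub y x
      rw [abs_sub_comm] at this
      nlinarith [abs_nonneg (x - y), abs_nonneg x]
    calc _ ≤ |w x - w₂ x| * ((1 + |x - y|) * (1 + |x|)) := by gcongr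
      _ = (1 + |x - y|) * ((1 + |x|) * |w x - w₂ x|) := by ring
      _ ≤ _ := by gcongr
  set n := N / (1 + |y|) with hn
  have hn0 : 0 ≤ n := by positivity
  have hny : (1 + |y|) * n = N := mul_div_cancel₀ N hyp.ne'
  suffices h : |w y + w₁ y| ≤ 24 * C * Real.exp (-(b - y)) + 6 * n by
    calc _ ≤ (1 + |y|) * (24 * C * Real.exp (-(b - y)) + 6 * n) := by gcongr
      _ = 24 * C * (1 + |y|) * Real.exp (-(b - y)) + 6 * ((1 + |y|) * n) := by ring
      _ = _ := by rw [hny]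
  have hp : w y + w₁ y = Real.exp y * (Real.exp (-y) * (w y + w₁ y)) := by
    rw [← mul_assoc, ← Real.exp_add]; simp
  have hfin : ∀ q : ℝ, |Real.exp (-y) * (w y + w₁ y) - Real.exp (-b') * (w b' + w₁ b')|
      ≤ Real.exp (-y) * q →
      |w y + w₁ y| ≤ Real.exp (y - b') * (3 * C) + q := fun q hq => by
    rw [hp, abs_mul, Real.abs_exp]
    have h3 := abs_sub_abs_le_abs_sub (Real.exp (-y) * (w y + w₁ y)) (Real.exp (-b') * (w b' + w₁ b'))
    rw [abs_mul (Real.exp (-b')), Real.abs_exp] at h3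
    have h4 : |Real.exp (-y) * (w y + w₁ y)| ≤ Real.exp (-b') * (3 * C) + Real.exp (-y) * q := by
      have : Real.exp (-b') * |w b' + w₁ b'| ≤ Real.exp (-b') * (3 * C) := by gcongr
      linarith
    calc _ ≤ Real.exp y * (Real.exp (-b') * (3 * C) + Real.exp (-y) * q) := by gcongr
      _ = (Real.exp y * Real.exp (-b')) * (3 * C) + (Real.exp y * Real.exp (-y)) * q := by ring
      _ = _ := by rw [← Real.exp_add, ← Real.exp_add, ← sub_eq_add_neg]; simp
  have hexp : Real.exp (y - b') ≤ 8 * Real.exp (-(b - y)) := by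
    have h3 : Real.exp (y - b') ≤ Real.exp 1 * Real.exp (-(b - y)) := by
      rw [← Real.exp_add]; exact Real.exp_le_exp.2 (by linarith [hb'.1])
    nlinarith [Real.exp_pos (-(b - y))]
  have hexp' : Real.exp (y - b') * (3 * C) ≤ 24 * C * Real.exp (-(b - y)) := by
    calc _ ≤ 8 * Real.exp (-(b - y)) * (3 * C) := by gcongr
      _ = _ := by ring
  rcases le_total y b' with hyb | hyb
  · have hB : ∀ x, HasDerivAt (fun x => -(n * (2 + (x - y)) * Real.exp (-x)))
        (n * (1 + (x - y)) * Real.exp (-x)) x := fun x =>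
      ((((((hasDerivAt_id' x).sub_const y).const_add 2).const_mul n).mul
        (hasDerivAt_neg x).exp).neg).congr_deriv (by ring)
    have h3 := abs_sub_le_of_abs_deriv_le hyb hE hB fun x hx => by
      rw [abs_neg, abs_mul, Real.abs_exp, mul_comm]
      have := hNx x ⟨hy.1.trans hx.1, hx.2.le.trans hb'.2.le⟩
      rw [abs_of_nonneg (sub_nonneg.2 hx.1)] at this
      gcongr
      linarith
    have h4 : 0 ≤ n * (2 + (b' - y)) * Real.exp (-b') := by
      have := sub_nonneg.2 hyb; positivity
    have h5 := hfin (2 * n) (by rw [abs_sub_comm]; exact h3.trans (by linarith))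
    linarith
  · have hB : ∀ x, HasDerivAt (fun x => -(2 * n * Real.exp (-x)))
        (2 * n * Real.exp (-x)) x := fun x =>
      (((hasDerivAt_neg x).exp.const_mul (2 * n)).neg).congr_deriv (by ring)
    have h3 := abs_sub_le_of_abs_deriv_le hyb hE hB fun x hx => by
      rw [abs_neg, abs_mul, Real.abs_exp, mul_comm]
      have h4 := hNx x ⟨by linarith [hb'.1, hx.1], hx.2.le.trans hy.2⟩
      rw [abs_of_nonpos (show x - y ≤ 0 by linarith [hx.2])] at h4
      gcongr
      have : -(x - y) ≤ 1 := by linarith [hb'.1, hx.1, hy.2]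
      nlinarith
    have h4 : Real.exp (-b') ≤ Real.exp (-y) * 3 := by
      have : Real.exp (-b') ≤ Real.exp (-y) * Real.exp 1 := by
        rw [← Real.exp_add]; exact Real.exp_le_exp.2 (by linarith [hb'.1, hy.2])
      nlinarith [Real.exp_pos (-y)]
    have h5 := hfin (6 * n) (h3.trans (by
      have h6 := mul_le_mul_of_nonneg_left h4 hn0
      have h7 := mul_nonneg hn0 (Real.exp_pos (-y)).le
      nlinarith))
    linarith

/-- Interior bound for `y w'` in terms of the distance to the ends of `[a, b]`. -/
theorem abs_mul_deriv_le {w w₁ w₂ : ℝ → ℝ} (h1 : ∀ x, HasDerivAt w (w₁ x) x)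
    (h2 : ∀ x, HasDerivAt w₁ (w₂ x) x) {C N a b y : ℝ} (hC : ∀ x, |w x| ≤ C)
    (hN : ∀ x ∈ Icc a b, (1 + |x|) * |w x - w₂ x| ≤ N) (hab : a + 1 ≤ b) (hy : y ∈ Icc a b) :
    |y * w₁ y| ≤ 12 * C * (1 + |y|) * (Real.exp (-(b - y)) + Real.exp (-(y - a))) + 6 * N := by
  have p1 := weighted_add_deriv_le h1 h2 hC hN hab hy
  have hn1 : ∀ x, HasDerivAt (fun x => w (-x)) (-w₁ (-x)) x := fun x =>
    ((h1 (-x)).comp x (hasDerivAt_neg x)).congr_deriv (by ring)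
  have hn2 : ∀ x, HasDerivAt (fun x => -w₁ (-x)) (w₂ (-x)) x := fun x =>
    ((h2 (-x)).comp x (hasDerivAt_neg x)).neg.congr_deriv (by ring)
  have p2 := weighted_add_deriv_le (a := -b) (b := -a) (y := -y) (N := N) hn1 hn2
    (fun x => hC (-x)) (fun x hx => by
      have := hN (-x) ⟨by linarith [hx.2], by linarith [hx.1]⟩
      rwa [abs_neg] at this) (by linarith) ⟨by linarith [hy.2], by linarith [hy.1]⟩
  simp only [neg_neg, abs_neg] at p2
  rw [show -a - -y = y - a by ring] at p2
  have e : 2 * (y * w₁ y) = y * (w y + w₁ y) - y * (w y + -w₁ y) := by ring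
  have h3 : 2 * |y * w₁ y| ≤ |y| * |w y + w₁ y| + |y| * |w y + -w₁ y| := by
    have := abs_sub (y * (w y + w₁ y)) (y * (w y + -w₁ y))
    rw [← e, abs_mul 2, abs_two, abs_mul y (w y + w₁ y), abs_mul y (w y + -w₁ y)] at this
    exact this
  have h4 := abs_nonneg (w y + w₁ y)
  have h5 := abs_nonneg (w y + -w₁ y)
  nlinarith

namespace IsFlow

variable {T C : ℝ} {V W Y : ℝ → ℝ → ℝ} (hV : WeakSol T C V W) (hY : IsFlow T V Y) (hT : 0 ≤ T)
  {N : ℝ} (hN : ∀ η, (1 + |η|) * |solVort V 0 η| ≤ N)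
include hV hY hT hN

/-- If the stretching lies in `[1/4, 4]` on the labels `|η| ≤ r`, then `u_y` is bounded there, up to
a term that decays exponentially in the distance to `|η| = r`. -/
theorem abs_velDeriv_le {t r : ℝ} (ht : t ∈ Icc 0 T) (hr : 2 ≤ r)
    (hq : ∀ η ∈ Icc (-r) r, 1 / 4 ≤ stretch V Y t η ∧ stretch V Y t η ≤ 4) {η : ℝ}
    (hη : |η| ≤ r) : |velDeriv V t (Y t η)| ≤
      C + 6 * (16384 * N) + 24 * C * (1 + 4 * r) * Real.exp (-((r - |η|) / 4)) := by
  have hr0 : 0 ≤ r := by linarith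
  -- Outside `[-r, r]` the stretching is replaced by its values at the ends.
  set q : ℝ → ℝ := fun x => stretch V Y t (max (-r) (min x r)) with hqdef
  have hmem : ∀ x : ℝ, max (-r) (min x r) ∈ Icc (-r) r := fun x =>
    ⟨le_max_left _ _, max_le (by linarith) (min_le_right _ _)⟩
  have hA : Adm q := ⟨(hY.continuous_stretch_right hV hT t).comp (by fun_prop),
    fun x => (hq _ (hmem x)).1, fun x => (hq _ (hmem x)).2⟩
  have hqid : ∀ x ∈ Icc (-r) r, q x = stretch V Y t x := fun x hx => by
    simp only [hqdef]; rw [min_eq_left hx.2, max_eq_right hx.1]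
  have hpos : ∀ x ∈ Icc (-r) r, pos q x = Y t x := fun x hx => by
    rw [← hY.pos_stretch hV hT ht]
    refine intervalIntegral.integral_congr fun z hz => hqid z ?_
    exact uIcc_subset_Icc (a₂ := -r) (b₂ := r) ⟨by linarith, hr0⟩ hx hz
  have havg : ∀ x ∈ Icc (-r) r, avg q x = avg (stretch V Y t) x := fun x hx => by
    refine intervalIntegral.integral_congr fun s hs => hqid _ ?_
    rw [uIcc_of_le zero_le_one] at hs
    rw [mem_Icc, ← _root_.abs_le, abs_mul, abs_of_nonneg hs.1]
    have := _root_.abs_le.2 hx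
    nlinarith [hs.1, hs.2, abs_nonneg x]
  have hηm : η ∈ Icc (-r) r := _root_.abs_le.1 hη
  have hrm : r ∈ Icc (-r) r := ⟨by linarith, le_rfl⟩
  have hrm' : -r ∈ Icc (-r) r := ⟨le_rfl, by linarith⟩
  have hvort : ∀ x ∈ Icc (Y t (-r)) (Y t r), (1 + |x|) * |V t x - deriv (deriv (V t)) x|
      ≤ 16384 * N := fun x hx => by
    have hx' : lab q x ∈ Icc (-r) r := by
      rw [← hpos _ hrm, ← hpos _ hrm', ← hA.pos_lab x] at hx
      exact ⟨hA.strictMono_pos.le_iff_le.1 hx.1, hA.strictMono_pos.le_iff_le.1 hx.2⟩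
    have h1 := hA.weighted_vort_le hN x
    have h2 : vort (solVort V 0) q x = V t x - deriv (deriv (V t)) x := by
      have h3 := hY.solVort_eq_dens hV hT ht (lab q x)
      rw [← hpos _ hx', hA.pos_lab] at h3
      change _ = solVort V t x
      rw [h3, vort, dens, dens, hqid _ hx', havg _ hx']
    rwa [h2] at h1
  have d1 := hA.le_pos_sub (a := η) (b := r) hηm.2
  have d2 := hA.le_pos_sub (a := -r) (b := η) hηm.1
  have d3 := hA.le_pos_sub (a := -r) (b := r) (by linarith)
  have d4 := hA.abs_pos_le η
  rw [hpos _ hηm] at d1 d2 d4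
  rw [hpos _ hrm] at d1 d3
  rw [hpos _ hrm'] at d2 d3
  have hC := hV.C_nonneg
  have key := abs_mul_deriv_le (w := V t) (y := Y t η) (hV.hasDerivAt_space t)
    (fun x => (hV.contDiff t).hasDerivAt_deriv_of_two x) (hV.bound t) hvort (by linarith)
    ⟨by linarith [hηm.1], by linarith [hηm.2]⟩
  have e1 : Real.exp (-(Y t r - Y t η)) ≤ Real.exp (-((r - |η|) / 4)) :=
    Real.exp_le_exp.2 (by linarith [le_abs_self η])
  have e2 : Real.exp (-(Y t η - Y t (-r))) ≤ Real.exp (-((r - |η|) / 4)) :=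
    Real.exp_le_exp.2 (by linarith [neg_abs_le η])
  have e3 : 1 + |Y t η| ≤ 1 + 4 * r := by linarith
  have key2 : 12 * C * (1 + |Y t η|) * (Real.exp (-(Y t r - Y t η)) + Real.exp (-(Y t η - Y t (-r))))
      ≤ 12 * C * (1 + 4 * r) * (Real.exp (-((r - |η|) / 4)) + Real.exp (-((r - |η|) / 4))) := by
    gcongr
  rw [velDeriv]
  refine (abs_add_le _ _).trans ?_
  linarith [hV.bound t (Y t η)]

/-- A stretching with values in `[1/2, 3/2]` at the time `t₀` stays in `[1/4, 4]` for a time `δ` that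
depends only on the bounds. No bound on `g_y` at infinity is known beforehand, so the argument runs
in the cones `|η| ≤ R (1 - κ (t - t₀))` and uses the control inside the cone only. What lies outside
contributes at most `R exp (-κ R (s - t) / 4)` to `u_y` at the time `t`, on a particle that is still
inside at the later time `s`, and the time integral of this is bounded by a multiple of `1/κ`,
uniformly in `R`. -/
theorem stretch_mem_of_le {κ δ t₀ t₁ : ℝ} (hκ : 4800 * (C + 1) ≤ κ)
    (hδ : δ * (10 * (C + 6 * (16384 * N)) + 2 * κ) ≤ 1) (h0 : 0 ≤ t₀) (h1T : t₁ ≤ T)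
    (h1 : t₁ ≤ t₀ + δ) (hq : ∀ η, 1 / 2 ≤ stretch V Y t₀ η ∧ stretch V Y t₀ η ≤ 3 / 2) {t : ℝ}
    (ht : t ∈ Icc t₀ t₁) (η : ℝ) : 1 / 4 < stretch V Y t η ∧ stretch V Y t η < 4 := by
  have hC := hV.C_nonneg
  have hN0 : 0 ≤ N := le_trans (by positivity) (hN 0)
  have hκ0 : 0 < κ := by linarith
  have hδ0 : 0 ≤ δ := by linarith [ht.1, ht.2]
  have hδκ : κ * δ ≤ 1 / 2 := by nlinarith
  have hδC : (C + 6 * (16384 * N)) * δ ≤ 1 / 10 := by nlinarith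
  -- Any `R ≥ 2 |η|` will do, since the cone never shrinks below half its width.
  set R : ℝ := 2 * |η| + 4 with hR
  have hR4 : 4 ≤ R := by linarith [abs_nonneg η]
  set r : ℝ → ℝ := fun s => R * (1 - κ * (s - t₀)) with hr
  have hrl : ∀ s ∈ Icc t₀ t₁, R / 2 ≤ r s := fun s hs => by
    have : κ * (s - t₀) ≤ κ * δ := mul_le_mul_of_nonneg_left (by linarith [hs.2]) hκ0.le
    simp only [hr]; nlinarith
  have hru : ∀ s ∈ Icc t₀ t₁, r s ≤ R := fun s hs => by
    have : 0 ≤ κ * (s - t₀) := mul_nonneg hκ0.le (by linarith [hs.1])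
    simp only [hr]; nlinarith
  have cq := hY.continuous_stretch hV hT
  set S : Set (ℝ × ℝ) := {p | (p.1 ∈ Icc t₀ t₁ ∧ |p.2| ≤ r p.1) ∧
    (stretch V Y p.1 p.2 ≤ 1 / 4 ∨ 4 ≤ stretch V Y p.1 p.2)} with hS
  have hScl : IsClosed S := by
    refine IsClosed.inter (IsClosed.inter (isClosed_Icc.preimage continuous_fst)
      (isClosed_le (f := fun p : ℝ × ℝ => |p.2|) (g := fun p : ℝ × ℝ => r p.1) (by fun_prop)
        (by fun_prop))) (IsClosed.union (isClosed_le cq continuous_const)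
      (isClosed_le continuous_const cq))
  have hSc : IsCompact S := by
    refine (isCompact_Icc.prod isCompact_Icc).of_isClosed_subset (s := Icc t₀ t₁ ×ˢ Icc (-R) R) hScl
      fun p hp => ⟨hp.1.1, _root_.abs_le.1 (hp.1.2.trans (hru _ hp.1.1))⟩
  have hSe : S = ∅ := by
    by_contra hne
    -- A violation at the earliest time: before it, the bounds hold on the whole cone.
    obtain ⟨⟨s', ξ⟩, ⟨⟨hs', hξ⟩, hbad⟩, hmin⟩ :=
      hSc.exists_isMinOn (nonempty_iff_ne_empty.2 hne) (f := Prod.fst) continuous_fst.continuousOn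
    simp only at hs' hξ hbad
    have hgood : ∀ s ∈ Ico t₀ s', ∀ x ∈ Icc (-r s) (r s),
        1 / 4 ≤ stretch V Y s x ∧ stretch V Y s x ≤ 4 := fun s hs x hx => by
      by_contra hcon
      have hm : (s, x) ∈ S := by
        refine ⟨⟨⟨hs.1, hs.2.le.trans hs'.2⟩, _root_.abs_le.2 hx⟩, ?_⟩
        by_contra h
        rw [not_or, not_le, not_le] at h
        exact hcon ⟨h.1.le, h.2.le⟩
      exact absurd (hmin hm) (not_le.2 hs.2)
    have c0 : Continuous fun s => velDeriv V s (Y s ξ) :=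
      (hY.continuous_velDeriv hV hT).comp (continuous_id.prodMk continuous_const)
    have hκR : 0 < κ * R := mul_pos hκ0 (by linarith)
    have hB : ∀ s, HasDerivAt (fun s => (C + 6 * (16384 * N)) * s
        + 480 * C / κ * Real.exp (-(κ * R * (s' - s) / 4)))
        ((C + 6 * (16384 * N)) + 120 * C * R * Real.exp (-(κ * R * (s' - s) / 4))) s := fun s => by
      have e1 : HasDerivAt (fun s => -(κ * R * (s' - s) / 4)) (κ * R / 4) s :=
        ((((hasDerivAt_id' s).const_sub s').const_mul (κ * R)).div_const 4).neg.congr_deriv (by ring)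
      refine (((hasDerivAt_id' s).const_mul _).add (e1.exp.const_mul _)).congr_deriv ?_
      field_simp
      ring
    have key := abs_sub_le_of_abs_deriv_le hs'.1
      (fun s => (c0.integral_hasStrictDerivAt 0 s).hasDerivAt) hB fun s hs => by
      have hsI : s ∈ Icc t₀ t₁ := ⟨hs.1, hs.2.le.trans hs'.2⟩
      have hd : κ * R * (s' - s) ≤ r s - |ξ| := by
        have : r s - r s' = κ * R * (s' - s) := by simp only [hr]; ring
        linarith
      have h2 := hY.abs_velDeriv_le hV hT hN (t := s) (r := r s) (η := ξ)
        ⟨h0.trans hs.1, hsI.2.trans h1T⟩ (by linarith [hrl s hsI]) (hgood s hs)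
        (by nlinarith [mul_nonneg hκR.le (sub_nonneg.2 hs.2.le)])
      have h3 : Real.exp (-((r s - |ξ|) / 4)) ≤ Real.exp (-(κ * R * (s' - s) / 4)) :=
        Real.exp_le_exp.2 (by linarith)
      have h4 : 1 + 4 * r s ≤ 5 * R := by linarith [hru s hsI]
      have h5 : 24 * C * (1 + 4 * r s) * Real.exp (-((r s - |ξ|) / 4))
          ≤ 24 * C * (5 * R) * Real.exp (-(κ * R * (s' - s) / 4)) := by
        have := hrl s hsI
        gcongr
      linarith
    simp only [sub_self, mul_zero, zero_div, neg_zero, Real.exp_zero, mul_one] at key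
    have h2 : 480 * C / κ ≤ 1 / 10 := by rw [div_le_iff₀ hκ0]; linarith
    have h3 : 0 ≤ 480 * C / κ * Real.exp (-(κ * R * (s' - t₀) / 4)) := by positivity
    have h4 : (C + 6 * (16384 * N)) * s' - (C + 6 * (16384 * N)) * t₀ ≤ 1 / 10 := by
      rw [← mul_sub]
      refine le_trans ?_ hδC
      gcongr
      linarith [hs'.2]
    have h5 : |(∫ s in (0 : ℝ)..s', velDeriv V s (Y s ξ)) - ∫ s in (0 : ℝ)..t₀, velDeriv V s (Y s ξ)|
        ≤ 1 / 5 := by linarith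
    set D := (∫ s in (0 : ℝ)..s', velDeriv V s (Y s ξ)) - ∫ s in (0 : ℝ)..t₀, velDeriv V s (Y s ξ)
      with hDdef
    have h6 : stretch V Y s' ξ = stretch V Y t₀ ξ * Real.exp D := by
      rw [stretch, stretch, ← Real.exp_add, hDdef]; ring_nf
    have hD := _root_.abs_le.1 h5
    -- `[1/2, 3/2]` is stretched by a factor in `[4/5, 5/4]`, which does not reach `1/4` or `4`.
    have h7 : 4 / 5 ≤ Real.exp D := by
      have := Real.add_one_le_exp D; linarith [hD.1]
    have h8 : Real.exp D ≤ 5 / 4 := by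
      have h9 : 4 / 5 ≤ Real.exp (-D) := by
        have := Real.add_one_le_exp (-D); linarith [hD.2]
      have h10 : Real.exp D * Real.exp (-D) = 1 := by rw [← Real.exp_add]; simp
      nlinarith [Real.exp_pos D]
    have h9 := hq ξ
    rcases hbad with hb | hb <;> rw [h6] at hb <;> nlinarith [Real.exp_pos D]
  have hnot : (t, η) ∉ S := by rw [hSe]; exact notMem_empty _
  by_contra hcon
  refine hnot ⟨⟨ht, ?_⟩, ?_⟩
  · have := hrl t ht; simp only; linarith
  · by_contra h
    rw [not_or, not_le, not_le] at h
    exact hcon h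

/-- A solution is recovered from the stretching of its flow. Boundedness of the solution selects the
Green operator. -/
theorem eq_green_vort {t : ℝ} (ht : t ∈ Icc 0 T) (hA : Adm (stretch V Y t)) :
    V t = green (vort (solVort V 0) (stretch V Y t)) := by
  refine eq_green (hV.contDiff t) (hV.bound t) (hA.abs_vort_le hN) fun x => ?_
  have h3 := hY.solVort_eq_dens hV hT ht (lab (stretch V Y t) x)
  rw [← hY.pos_stretch hV hT ht, hA.pos_lab] at h3
  exact h3

/-- As long as it lies in `[1/4, 4]`, the stretching of the flow of a solution solves the equation
`q_t = Y_η (g + Y g_y)` with `g` expressed by `q`. -/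
theorem hasDerivAt_stretch_vel {t : ℝ} (ht : t ∈ Icc 0 T) (hA : Adm (stretch V Y t)) (η : ℝ) :
    HasDerivAt (fun s => stretch V Y s η) (vel (solVort V 0) (stretch V Y t) η) t := by
  refine (hY.hasDerivAt_stretch hV hT t η).congr_deriv ?_
  have h1 := hY.eq_green_vort hV hT hN ht hA
  have h2 : deriv (V t) = greenD (vort (solVort V 0) (stretch V Y t)) := by
    rw [h1, deriv_green (hA.continuous_vort (hV.continuous_solVort_right 0)) (hA.abs_vort_le hN)]
  rw [vel, hY.pos_stretch hV hT ht, velDeriv, h2, ← h1]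

/-- On a short time interval the stretching of the flow agrees with a given path that starts from
the same value. -/
theorem stretch_eq_of_le {T₀ L : ℝ} {Q : ℝ → ℝ → ℝ} (hQ : IsPath (solVort V 0) T₀ L Q)
    (hTT : T < T₀) {κ δ t₀ t₁ : ℝ} (hκ : 4800 * (C + 1) ≤ κ)
    (hδ : δ * (10 * (C + 6 * (16384 * N)) + 2 * κ) ≤ 1)
    (hδ' : δ * (29 * (335872 * N * kerMass)) ≤ 1 / 2) (h0 : 0 ≤ t₀) (h1T : t₁ ≤ T)
    (h1 : t₁ ≤ t₀ + δ) (heq : ∀ η, stretch V Y t₀ η = Q t₀ η) {t : ℝ}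
    (ht : t ∈ Icc t₀ t₁) (η : ℝ) : stretch V Y t η = Q t η := by
  have hφ := hV.continuous_solVort_right 0
  have hN0 : 0 ≤ N := le_trans (by positivity) (hN 0)
  have hK := kerMass_nonneg
  have hA : ∀ s ∈ Icc t₀ t₁, Adm (stretch V Y s) := fun s hs => by
    have h := fun η => hY.stretch_mem_of_le hV hT hN hκ hδ h0 h1T h1
      (fun η => by rw [heq η]; exact ⟨hQ.lower t₀ η, hQ.upper t₀ η⟩) hs η
    exact ⟨hY.continuous_stretch_right hV hT s, fun η => (h η).1.le, fun η => (h η).2.le⟩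
  have hT' : ∀ s ∈ Icc t₀ t₁, s ∈ Icc 0 T := fun s hs => ⟨h0.trans hs.1, hs.2.trans h1T⟩
  -- Every bound for the difference can be halved.
  have hhalf : ∀ n : ℕ, ∀ s ∈ Icc t₀ t₁, ∀ η, |stretch V Y s η - Q s η| ≤ 4 * (1 / 2) ^ n := by
    intro n
    induction n with
    | zero =>
      intro s hs η
      have a1 := (hA s hs).lower η
      have a2 := (hA s hs).upper η
      rw [pow_zero, mul_one, _root_.abs_le]
      constructor <;> linarith [hQ.lower s η, hQ.upper s η]
    | succ n ih =>
      intro s hs η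
      have h2 := (convex_Icc t₀ t₁).norm_image_sub_le_of_norm_hasDerivWithin_le
        (f := fun s => stretch V Y s η - Q s η)
        (C := 29 * (335872 * N * kerMass) * (4 * (1 / 2) ^ n))
        (fun s hs => ((hY.hasDerivAt_stretch_vel hV hT hN (hT' s hs) (hA s hs) η).sub
          (hQ.hasDerivAt s ⟨by linarith [(hT' s hs).1, (hT' s hs).2], (hT' s hs).2.trans_lt hTT⟩
            η)).hasDerivWithinAt)
        (fun s hs => Adm.abs_vel_sub_le hφ hN (hA s hs) (hQ.adm s) (ih s hs) η)
        ⟨le_rfl, hs.1.trans hs.2⟩ hs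
      rw [heq, sub_self, sub_zero, Real.norm_eq_abs, Real.norm_eq_abs,
        abs_of_nonneg (sub_nonneg.2 hs.1)] at h2
      have h3 : (0 : ℝ) ≤ 4 * (1 / 2) ^ n := by positivity
      have h4 : s - t₀ ≤ δ := by linarith [hs.2]
      calc |stretch V Y s η - Q s η|
          ≤ 29 * (335872 * N * kerMass) * (4 * (1 / 2) ^ n) * (s - t₀) := h2
        _ ≤ 29 * (335872 * N * kerMass) * (4 * (1 / 2) ^ n) * δ := by gcongr
        _ = δ * (29 * (335872 * N * kerMass)) * (4 * (1 / 2) ^ n) := by ring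
        _ ≤ 1 / 2 * (4 * (1 / 2) ^ n) := by gcongr
        _ = 4 * (1 / 2) ^ (n + 1) := by rw [pow_succ]; ring
  refine sub_eq_zero.1 (abs_nonpos_iff.1 (ge_of_tendsto' (x := atTop) (f := fun n : ℕ => (4 : ℝ) * (1 / 2) ^ n)
    (b := |stretch V Y t η - Q t η|) ?_ fun n => hhalf n t ht η))
  simpa using (tendsto_pow_atTop_nhds_zero_of_lt_one (r := (1 / 2 : ℝ)) (by norm_num)
    (by norm_num)).const_mul 4

/-- The stretching of the flow of a solution agrees with the path constructed from the same initial
value, as long as both exist. -/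
theorem stretch_eq {T₀ L : ℝ} {Q : ℝ → ℝ → ℝ} (hQ : IsPath (solVort V 0) T₀ L Q)
    (hTT : T < T₀) {t : ℝ} (ht : t ∈ Icc 0 T) (η : ℝ) : stretch V Y t η = Q t η := by
  have hC := hV.C_nonneg
  have hN0 : 0 ≤ N := le_trans (by positivity) (hN 0)
  have hK := kerMass_nonneg
  set κ := 4800 * (C + 1) with hκ
  have hκ0 : 0 < κ := by positivity
  set c := 10 * (C + 6 * (16384 * N)) + 2 * κ + 58 * (335872 * N * kerMass) with hc
  have hc0 : 0 < c := by positivity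
  have hNK : 0 ≤ 335872 * N * kerMass := by positivity
  have hδ1 : 1 / c * (10 * (C + 6 * (16384 * N)) + 2 * κ) ≤ 1 := by
    rw [one_div_mul_eq_div, div_le_one hc0, hc]; linarith
  have hδ2 : 1 / c * (29 * (335872 * N * kerMass)) ≤ 1 / 2 := by
    rw [one_div_mul_eq_div, div_le_iff₀ hc0, hc]
    have : 0 ≤ 10 * (C + 6 * (16384 * N)) + 2 * κ := by positivity
    linarith
  -- Steps of the length `1 / c`, which is the same at every starting time.
  have hstep : ∀ n : ℕ, ∀ t ∈ Icc 0 T, t ≤ n * (1 / c) → ∀ η, stretch V Y t η = Q t η := by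
    intro n
    induction n with
    | zero =>
      intro t ht htn η
      have h0 : t = 0 := le_antisymm (by simpa using htn) ht.1
      rw [h0, hQ.init, stretch, intervalIntegral.integral_same, Real.exp_zero]
    | succ n ih =>
      intro t ht htn η
      rcases le_total t (n * (1 / c)) with h | h
      · exact ih t ht h η
      · have hn0 : 0 ≤ n * (1 / c) := by positivity
        exact hY.stretch_eq_of_le hV hT hN hQ hTT (t₁ := t) le_rfl hδ1 hδ2 hn0 ht.2
          (htn.trans_eq (by push_cast; ring)) (ih _ ⟨hn0, h.trans ht.2⟩ le_rfl) ⟨h, le_rfl⟩ η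
  obtain ⟨n, hn⟩ := exists_nat_ge (t * c)
  refine hstep n t ht ?_ η
  rw [mul_one_div, le_div_iff₀ hc0]
  exact hn

end IsFlow

/-- The decay hypothesis implies the weaker one used above. -/
theorem exists_weight_bound {φ₀ : ℝ → ℝ} (hφ : Continuous φ₀) {M : ℝ}
    (hM : ∀ y, y ^ 2 * |φ₀ y| ≤ M) : ∃ N, ∀ η, (1 + |η|) * |φ₀ η| ≤ N := by
  obtain ⟨C, hC⟩ := (isCompact_Icc (a := (-1 : ℝ)) (b := 1)).exists_bound_of_continuousOn
    hφ.continuousOn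
  have hC0 : 0 ≤ C := (norm_nonneg _).trans (hC 0 ⟨by norm_num, by norm_num⟩)
  have hM0 : 0 ≤ M := le_trans (by positivity) (hM 0)
  refine ⟨2 * C + 2 * M, fun η => ?_⟩
  have h0 := abs_nonneg (φ₀ η)
  rcases le_total |η| 1 with h | h
  · have h1 : |φ₀ η| ≤ C := hC η (abs_le.1 h)
    nlinarith
  · have h1 := hM η
    rw [← sq_abs] at h1
    have h2 : 1 + |η| ≤ 2 * |η| ^ 2 := by nlinarith
    nlinarith

theorem theorem2p3 (g₀ : ℝ → ℝ) (hg₀ : ContDiff ℝ 2 g₀)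
    (hbdd : ∃ C : ℝ, ∀ y, |g₀ y| ≤ C)
    (hdecay : ∃ M : ℝ, ∀ y, y ^ 2 * |g₀ y - deriv (deriv g₀) y| ≤ M) :
    ∃ T : ℝ, 0 < T ∧ ∃ g : ℝ → ℝ → ℝ, IsSolution T g₀ g ∧
      ∀ h : ℝ → ℝ → ℝ, IsSolution T g₀ h → ∀ t ∈ Ico 0 T, ∀ y, h t y = g t y := by
  obtain ⟨C, hC⟩ := hbdd
  obtain ⟨M, hM⟩ := hdecay
  set φ₀ : ℝ → ℝ := fun y => g₀ y - deriv (deriv g₀) y with hφ₀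
  have hφ : Continuous φ₀ := hg₀.continuous.sub hg₀.continuous_deriv_deriv
  obtain ⟨N, hN⟩ := exists_weight_bound hφ hM
  obtain ⟨T, hT, L, Q, hQ⟩ := exists_isPath hφ hN
  refine ⟨T, hT, fun t => green (vort φ₀ (Q t)), hQ.isSolution hφ hN hg₀ hC fun _ => rfl,
    fun h hh t ht y => ?_⟩
  obtain ⟨C', W, hV⟩ := hh.exists_weakSol ht.1 ht.2
  obtain ⟨Y, hY⟩ := hV.exists_isFlow ht.1
  have hh0 : h 0 = g₀ := funext hh.initial
  have hv0 : solVort (fun s => h (max 0 (min s t))) 0 = φ₀ := by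
    ext x
    simp only [solVort, min_eq_left ht.1, max_self, hh0, hφ₀]
  have htt : t ∈ Icc 0 t := ⟨ht.1, le_rfl⟩
  have hs : stretch (fun s => h (max 0 (min s t))) Y t = Q t := funext fun η =>
    hY.stretch_eq hV ht.1 (hv0.symm ▸ hN) (hv0.symm ▸ hQ) ht.2 htt η
  have h1 := hY.eq_green_vort hV ht.1 (hv0.symm ▸ hN) htt (hs.symm ▸ hQ.adm t)
  rw [hs, hv0] at h1
  simp only [min_self, max_eq_right ht.1] at h1
  rw [h1]
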